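/- Notation: $[m]=\{1,\dots,m\}$, $\mathbb{Z}_b=\{0,\dots,b-1\}$, $\log$ is the natural logarithm. In the (multi-message, private-coin) shuffle model, each of $n$ users applies a local randomizer, with its own independent coins, to its input in $[B]$ and sends a multiset of messages; the analyzer sees only the multiset union of all messages. The protocol is $(\varepsilon,\delta)$-differentially private if for any two datasets $D,D'\in[B]^n$ differing in one entry and any set $Y$ of multisets, $\Pr[\mathrm{View}(D)\in Y]\le e^{\varepsilon}\Pr[\mathrm{View}(D')\in Y]+\delta$. The protocol $\mathcal{P}^{\mathrm{FE1}}$. Let $n\ge 1$, $0<\varepsilon\le 3$, $0<\delta<1$, and let $B,b$ be integers with $2\le b\le B/2$. Let $q\in[B,2B)$ be a prime (one exists), and put $$\rho=\frac{32\ln(2/\delta)}{\varepsilon^2}\cdot\frac bn,\qquad h_{u,v}(x)=((ux+v)\bmod q)\bmod b,\qquad p_{\mathrm{col}}=\frac{\lfloor q/b\rfloor\,\bigl((q\bmod b)+q-b\bigr)}{q(q-1)} .$$ A user with input $x$ draws $(u,v)\in[q-1]\times[q]$ uniformly and sends $(u,v,h_{u,v}(x))$; it also sends $\lfloor\rho\rfloor$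 independent uniform elements of $[q-1]\times[q]\times\mathbb{Z}_b$ and, with probability $\rho-\lfloor\rho\rfloor$, one more. For a query $x\in[B]$ the analyzer counts the number $X$ of received tuples $(u,v,w)$ with $h_{u,v}(x)=w$ and returns $\hat g(x)=(X-n\rho/b-n\,p_{\mathrm{col}})/(1-p_{\mathrm{col}})$. Theorem. For all $n,B,b,\varepsilon,\delta,q$ as above, with absolute constants in all $O(\cdot)$ except the last: 1. $\mathcal{P}^{\mathrm{FE1}}$ is $(\varepsilon,\delta)$-differentially private in the shuffle model. 2. Each user sends $1+O\left(\frac{\log(2/\delta)}{\varepsilon^2}\cdot\frac bn\right)$ messages in expectation, each consisting of $O(\log B)$ bits. 3. On a unit-cost RAM whose integer words have $O(\log(B+n+N))$ bits, $N$ being the number of received messages, and with unit-cost real arithmetic (including $\ln$) for the estimates, there is one program that, for every dataset and every $x\in[B]$, outputs $\hat g(x)$ in expected time $O\left(n+\frac{\log(2/\delta)}{\varepsilon^2}\cdot b\right)$, and one program that, for every dataset, outputs $\hat g(x)$ for all $x\in[B]$ in expected time $O\left(\left(\frac nb+\frac{\log(2/\delta)}{\varepsilon^2}\right)\cdot B\right)$.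 4. For every constant $\beta\in(0,1)$ and every dataset, with probability greater than $1-\beta$ the maximum error $\max_{x\in[B]}|\hat g(x)-g(x)|$, where $g(x)$ is the number of users holding $x$, is $$O\left(\log B+\sqrt{\log B\left(\frac nb+\frac{\log(2/\delta)}{\varepsilon^2}\right)}\right),$$ where the constant depends only on $\beta$. (For $\delta\le 1/2$ one may replace $\log(2/\delta)$ by $\log(1/\delta)$ throughout.) -/

import Mathlib

open scoped ENNReal

noncomputable section

namespace ShuffleFE

/-! ### The multi-message shuffle model -/

/-- A private-coin protocol in the multi-message shuffle model.  Each user applies the local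
randomizer to its own input, with its own random coins only, and sends a multiset of messages;
the analyzer sees only the multiset union of all of them. -/
structure Protocol (X M Out : Type*) where
  randomizer : X → PMF (Multiset M)
  analyzer : Multiset M → Out

namespace Protocol

variable {X M Out : Type*}

/-- The law of the multiset of all messages that `n` users with inputs `D 0, …, D (n - 1)` send,
the users being independent. -/
def view (P : Protocol X M Out) : {n : ℕ} → (Fin n → X) → PMF (Multiset M)
  | 0, _ => PMF.pure 0
  | _ + 1, D =>
    (P.randomizer (D 0)).bind fun S =>
      (P.view (Fin.tail D)).bind fun T => PMF.pure (S + T)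

/-- The law of the output of the analyzer. -/
def output (P : Protocol X M Out) {n : ℕ} (D : Fin n → X) : PMF Out :=
  (P.view D).map P.analyzer

/-- The expected number of messages sent by a user with input `x`. -/
def expectedMessages (P : Protocol X M Out) (x : X) : ℝ≥0∞ :=
  ∑' T : Multiset M, P.randomizer x T * (T.card : ℝ≥0∞)

end Protocol

/-- `(ε, δ)`-differential privacy of a mechanism on datasets of size `n`; two datasets are
neighbours if they differ in (at most) one entry. -/
def IsDP {X Y : Type*} {n : ℕ} (M : (Fin n → X) → PMF Y) (ε δ : ℝ) : Prop :=
  ∀ D D' : Fin n → X, (∃ i, ∀ j, j ≠ i → D j = D' j) →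
    ∀ S : Set Y, (M D).toOuterMeasure S ≤
      ENNReal.ofReal (Real.exp ε) * (M D').toOuterMeasure S + ENNReal.ofReal δ

/-- The number of users that hold the element `j`. -/
def trueFreq {X : Type*} {n : ℕ} (D : Fin n → X) (j : X) : ℕ :=
  Nat.card {i : Fin n // D i = j}

/-- `(α, β)`-accuracy for frequency estimation with `n` users: on every dataset, the probability
that the maximum error over all elements exceeds `α` is less than `β`. -/
def IsAccurate {X M : Type*} (P : Protocol X M (X → ℝ)) (n : ℕ) (α β : ℝ) : Prop :=
  ∀ D : Fin n → X,
    (P.output D).toOuterMeasure {g | ∃ j, α < |g j - (trueFreq D j : ℝ)|} < ENNReal.ofReal β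

/-! ### The hashing protocol -/

/-- The set `[m] = {1, …, m}`. -/
abbrev Range1 (m : ℕ) : Type := ↥(Finset.Icc 1 m)

/-- Hash seeds `(u, v) ∈ [q - 1] × [q]`. -/
abbrev Seed (q : ℕ) : Type := Range1 (q - 1) × Range1 q

/-- Messages `((u, v), w) ∈ ([q - 1] × [q]) × {0, …, b - 1}`. -/
abbrev Message (q b : ℕ) : Type := Seed q × Fin b

instance instNonemptySeed (q : ℕ) [Fact q.Prime] : Nonempty (Seed q) :=
  have h := (Fact.out : q.Prime).two_le
  ⟨⟨⟨1, Finset.mem_Icc.2 ⟨le_rfl, by omega⟩⟩, ⟨1, Finset.mem_Icc.2 ⟨le_rfl, by omega⟩⟩⟩⟩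

/-- The hash function `h_{u,v}(x) = ((u x + v) mod q) mod b`. -/
def hash {q : ℕ} (b : ℕ) [NeZero b] (s : Seed q) (x : ℕ) : Fin b :=
  Fin.ofNat b (((s.1 : ℕ) * x + (s.2 : ℕ)) % q)

/-- The expected number `ρ = (32 ln(2/δ) / ε²) (b / n)` of blanket noises per user. -/
def rho (n b : ℕ) (ε δ : ℝ) : ℝ :=
  32 * Real.log (2 / δ) / ε ^ 2 * ((b : ℝ) / (n : ℝ))

/-- The collision probability of the hash family, `⌊q/b⌋ ((q mod b) + q - b) / (q (q - 1))`. -/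
def pcol (q b : ℕ) : ℝ :=
  ((q / b : ℕ) : ℝ) * (((q % b : ℕ) : ℝ) + (q : ℝ) - (b : ℝ)) / ((q : ℝ) * ((q : ℝ) - 1))

/-- A coin that shows `true` with probability `p`. -/
def coin (p : ℝ) (h0 : 0 ≤ p) (h1 : p ≤ 1) : PMF Bool :=
  PMF.ofFintype (fun y => ENNReal.ofReal (if y then p else 1 - p)) (by
    simp only [Fintype.sum_bool, if_true, Bool.false_eq_true, if_false]
    rw [← ENNReal.ofReal_add h0 (by linarith)]
    simp)

/-- `k` independent blanket noises, each uniform on the set of messages. -/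
def blanketNoise (q b : ℕ) [Fact q.Prime] [NeZero b] : ℕ → PMF (Multiset (Message q b))
  | 0 => PMF.pure 0
  | k + 1 =>
    (PMF.uniformOfFintype (Message q b)).bind fun m =>
      (blanketNoise q b k).bind fun T => PMF.pure (m ::ₘ T)

/-- The local randomizer: the real output `(u, v, h_{u,v}(x))` for a uniform seed, `⌊ρ⌋` blanket
noises, and with probability `ρ - ⌊ρ⌋` one more blanket noise. -/
def randomizer (n b q : ℕ) (ε δ : ℝ) [Fact q.Prime] [NeZero b] (x : ℕ) :
    PMF (Multiset (Message q b)) :=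
  (PMF.uniformOfFintype (Seed q)).bind fun s =>
    (coin (Int.fract (rho n b ε δ)) (Int.fract_nonneg _) (Int.fract_lt_one _).le).bind fun y =>
      (blanketNoise q b (⌊rho n b ε δ⌋₊ + if y then 1 else 0)).bind fun T =>
        PMF.pure ((s, hash b s x) ::ₘ T)

/-- The estimate `(X - n ρ / b - n p_col) / (1 - p_col)` of the frequency of `x`, where `X` is the
number of received messages `(u, v, w)` with `h_{u,v}(x) = w`. -/
def estimate (n b q : ℕ) (ε δ : ℝ) [NeZero b] (T : Multiset (Message q b)) (x : ℕ) : ℝ :=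
  ((T.countP (fun m => hash b m.1 x = m.2) : ℝ) - n * rho n b ε δ / b - n * pcol q b)
    / (1 - pcol q b)

/-- The hashing protocol for `n` users with inputs in `[B]`. -/
def FE1 (n B b q : ℕ) (ε δ : ℝ) [Fact q.Prime] [NeZero b] :
    Protocol (Range1 B) (Message q b) (Range1 B → ℝ) where
  randomizer x := randomizer n b q ε δ x
  analyzer T x := estimate n b q ε δ T x

/-- The number of bits of a message: two fields for the seed and one for the hash value. -/
def messageBits (q b : ℕ) : ℕ := Nat.size q + Nat.size q + Nat.size b

/-- The bit string that is sent for a message: the binary expansions of `u`, `v`, `w`. -/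
def encodeMessage {q b : ℕ} (m : Message q b) : BitVec (messageBits q b) :=
  BitVec.ofNat (Nat.size q) m.1.1 ++ BitVec.ofNat (Nat.size q) m.1.2 ++
    BitVec.ofNat (Nat.size b) m.2

/-! ### The machine model

A unit-cost random access machine with `w`-bit integer words.  Its memory consists of integer
registers, integer arrays that are addressed by words, and real registers and real arrays for the
real-valued estimates (real arithmetic and the logarithm are unit-cost, as on a real RAM; reals can
be neither tested nor converted to integers).  Registers and arrays are named by literals of the
program text, so a program uses a constant number of them. -/

structure State where
  int : ℕ → ℕ
  arr : ℕ → ℕ → ℕ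
  real : ℕ → ℝ
  rarr : ℕ → ℕ → ℝ

inductive IntOp
  | add | sub | mul | div | mod

/-- Integer arithmetic on `w`-bit words; subtraction is truncated at `0`. -/
def IntOp.eval (w : ℕ) : IntOp → ℕ → ℕ → ℕ
  | .add, a, b => (a + b) % 2 ^ w
  | .sub, a, b => (a - b) % 2 ^ w
  | .mul, a, b => (a * b) % 2 ^ w
  | .div, a, b => (a / b) % 2 ^ w
  | .mod, a, b => (a % b) % 2 ^ w

inductive RealOp
  | add | sub | mul | div

def RealOp.eval : RealOp → ℝ → ℝ → ℝ
  | .add, a, b => a + b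
  | .sub, a, b => a - b
  | .mul, a, b => a * b
  | .div, a, b => a / b

inductive Instr
  /-- integer register `i` := the literal `c` -/
  | const (i c : ℕ)
  /-- integer register `i` := (register `j`) `o` (register `k`) -/
  | iop (o : IntOp) (i j k : ℕ)
  /-- integer register `i` := integer array `a` at the index in register `j` -/
  | load (i a j : ℕ)
  /-- integer array `a` at the index in register `j` := integer register `i` -/
  | store (a j i : ℕ)
  /-- real register `r` := integer register `i` -/
  | cast (r i : ℕ)
  /-- real register `r` := (real register `s`) `o` (real register `t`) -/
  | rop (o : RealOp) (r s t : ℕ)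
  /-- real register `r` := logarithm of real register `s` -/
  | rlog (r s : ℕ)
  /-- real register `r` := real array `a` at the index in register `j` -/
  | rload (r a j : ℕ)
  /-- real array `a` at the index in register `j` := real register `r` -/
  | rstore (a j r : ℕ)

def Instr.eval (w : ℕ) : Instr → State → State
  | .const i c, σ => { σ with int := Function.update σ.int i (c % 2 ^ w) }
  | .iop o i j k, σ =>
    { σ with int := Function.update σ.int i (o.eval w (σ.int j) (σ.int k)) }
  | .load i a j, σ => { σ with int := Function.update σ.int i (σ.arr a (σ.int j)) }
  | .store a j i, σ =>
    { σ with arr := Function.update σ.arr a (Function.update (σ.arr a) (σ.int j) (σ.int i)) }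
  | .cast r i, σ => { σ with real := Function.update σ.real r (σ.int i : ℝ) }
  | .rop o r s t, σ =>
    { σ with real := Function.update σ.real r (o.eval (σ.real s) (σ.real t)) }
  | .rlog r s, σ => { σ with real := Function.update σ.real r (Real.log (σ.real s)) }
  | .rload r a j, σ => { σ with real := Function.update σ.real r (σ.rarr a (σ.int j)) }
  | .rstore a j r, σ =>
    { σ with rarr := Function.update σ.rarr a (Function.update (σ.rarr a) (σ.int j) (σ.real r)) }

/-- Programs.  `ifLt i j` and `whileLt i j` test whether integer register `i` is smaller than
integer register `j`. -/
inductive Prog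
  | instr (c : Instr)
  | seq (p₁ p₂ : Prog)
  | ifLt (i j : ℕ) (p₁ p₂ : Prog)
  | whileLt (i j : ℕ) (p : Prog)

/-- `Exec w p σ t σ'`: on words of `w` bits, program `p` started in state `σ` halts in state `σ'`
after exactly `t` steps; every instruction and every evaluation of a test is one step. -/
inductive Exec (w : ℕ) : Prog → State → ℕ → State → Prop
  | instr (c : Instr) (σ : State) : Exec w (.instr c) σ 1 (c.eval w σ)
  | seq {p₁ p₂ : Prog} {σ σ' σ'' : State} {t₁ t₂ : ℕ} :
      Exec w p₁ σ t₁ σ' → Exec w p₂ σ' t₂ σ'' → Exec w (.seq p₁ p₂) σ (t₁ + t₂) σ''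
  | ifTrue {i j : ℕ} {p₁ p₂ : Prog} {σ σ' : State} {t : ℕ} :
      σ.int i < σ.int j → Exec w p₁ σ t σ' → Exec w (.ifLt i j p₁ p₂) σ (t + 1) σ'
  | ifFalse {i j : ℕ} {p₁ p₂ : Prog} {σ σ' : State} {t : ℕ} :
      ¬ σ.int i < σ.int j → Exec w p₂ σ t σ' → Exec w (.ifLt i j p₁ p₂) σ (t + 1) σ'
  | whileTrue {i j : ℕ} {p : Prog} {σ σ' σ'' : State} {t₁ t₂ : ℕ} :
      σ.int i < σ.int j → Exec w p σ t₁ σ' → Exec w (.whileLt i j p) σ' t₂ σ'' →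
        Exec w (.whileLt i j p) σ (t₁ + t₂ + 1) σ''
  | whileFalse {i j : ℕ} {p : Prog} {σ : State} :
      ¬ σ.int i < σ.int j → Exec w (.whileLt i j p) σ 1 σ

/-- The number of steps of program `p` from `σ`; it is `⊤` if `p` does not halt. -/
def runTime (w : ℕ) (p : Prog) (σ : State) : ℝ≥0∞ :=
  ⨅ (t : ℕ) (σ' : State) (_ : Exec w p σ t σ'), (t : ℝ≥0∞)

/-- The initial state for the analyzer: the public parameters `n, B, q, b`, the number of received
messages and the queried element `x` in integer registers `0, …, 5`, the public parameters `ε, δ`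
in real registers `0, 1`, and the received messages, in the order of the list `l`, in integer
arrays `0, 1, 2`.  All other memory is `0`. -/
def initState (n B b q : ℕ) (ε δ : ℝ) (l : List (Message q b)) (x : ℕ) : State where
  int i := [n, B, q, b, l.length, x].getD i 0
  arr a i := (l[i]?).elim 0 fun m => [(m.1.1 : ℕ), (m.1.2 : ℕ), (m.2 : ℕ)].getD a 0
  real r := [ε, δ].getD r 0
  rarr _ _ := 0

/-- Word length for an instance with `N` received messages: `K` times the bit length of
`B + n + N`. -/
def wordLength (K n B N : ℕ) : ℕ := K * Nat.size (B + n + N)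

/-- `p` answers single queries: for all received messages, in any order, and every `x ∈ [B]` it
halts with the analyzer's estimate for `x` in real register `0`. -/
def AnswersQuery (K : ℕ) (p : Prog) (n B b q : ℕ) (ε δ : ℝ) [Fact q.Prime] [NeZero b] : Prop :=
  ∀ (l : List (Message q b)) (x : Range1 B), ∃ (t : ℕ) (σ : State),
    Exec (wordLength K n B l.length) p (initState n B b q ε δ l x) t σ ∧
      σ.real 0 = (FE1 n B b q ε δ).analyzer (l : Multiset (Message q b)) x

/-- `p` answers all queries: for all received messages, in any order, it halts with the analyzer's
estimate for every `x ∈ [B]` at index `x` of real array `0`. -/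
def AnswersAll (K : ℕ) (p : Prog) (n B b q : ℕ) (ε δ : ℝ) [Fact q.Prime] [NeZero b] : Prop :=
  ∀ l : List (Message q b), ∃ (t : ℕ) (σ : State),
    Exec (wordLength K n B l.length) p (initState n B b q ε δ l 0) t σ ∧
      ∀ x : Range1 B,
        σ.rarr 0 x = (FE1 n B b q ε δ).analyzer (l : Multiset (Message q b)) x

/-- The expected running time of `p` on dataset `D`, with `x` in the query register, for the worst
order of the received messages. -/
def expectedTime (K : ℕ) (p : Prog) {n B : ℕ} (b q : ℕ) (ε δ : ℝ) [Fact q.Prime] [NeZero b]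
    (D : Fin n → Range1 B) (x : ℕ) : ℝ≥0∞ :=
  ∑' T : Multiset (Message q b), (FE1 n B b q ε δ).view D T *
    ⨆ (l : List (Message q b)) (_ : (l : Multiset (Message q b)) = T),
      runTime (wordLength K n B l.length) p (initState n B b q ε δ l x)

end ShuffleFE

end

open scoped ENNReal

noncomputable section

set_option linter.unusedSectionVars false

namespace ShuffleFE

/-! ### Expectations of nonnegative functions -/

/-! Privacy. All noise together is a random number `k` of independent uniform messages. For each
seed exactly one hash value matches `x`, so the true message of a user holding `x` is uniform on the
messages matching `x`, a fraction `1 / b` of all. By size biasing, that message together with `k`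
noises has density `b X / (k + 1)` relative to `k + 1` noises, where `X` counts the matches of `x`
(`expect_real_add_blanketNoise`). The factor `b / (k + 1)` does not depend on the input, so
replacing `x` by `x'` changes the likelihood by the ratio `X / X'`, for every mixture over `k`
(`expect_real_add_mixture_le`). It remains to see that `X ≤ e^ε X'` fails with probability at most
`δ`. Both counts of noise matches have mean `μ = 32 ln (2 / δ) / ε ^ 2`, and two Chernoff bounds
give this without any independence between them (`noise_imbalance_le`). The true messages of the
other users are conditioned upon.

Accuracy. For `x ≠ x'`, a seed corresponds bijectively to the ordered pair of distinct residues
modulo `q` that it assigns to `x` and `x'`, so the collision probability is exactly `pcol`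
(`card_seed_collision_eq_pcol`). The number of matches of `x` then has mean `g + (n - g) pcol + n ρ
/ b`, which the estimate inverts up to the factor `1 - pcol ≥ 1 / 2`. Its exponential moment is at
most that of `g` plus a Poisson variable (`expect_view_expMatch_le`); a Chernoff bound and a union
bound over `x` finish.

Time. The programs run in time affine in the number `N` of messages, whatever their order, and `N`
has mean `n (1 + ρ)`. A single query tests every message. For all queries, the residues `t` matching
`(u, v, w)` are the `(y - v) / u` for `y = w, w + b, …` below `q`: about `q / b` of them, found
without search once the inverses modulo `q` are tabulated (`scatter_index`, `runs_scatter_loop`). -/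

/-- The expectation of a nonnegative function under a discrete distribution. -/
def expect {α : Type*} (P : PMF α) (f : α → ℝ≥0∞) : ℝ≥0∞ := ∑' a, P a * f a

section Expect

variable {α γ : Type*}

lemma expect_pure (a : α) (f : α → ℝ≥0∞) : expect (PMF.pure a) f = f a := by
  unfold expect
  rw [tsum_eq_single a]
  · simp
  · intro b hb
    simp [PMF.pure_apply, hb]

lemma expect_bind (P : PMF α) (Q : α → PMF γ) (f : γ → ℝ≥0∞) :
    expect (P.bind Q) f = expect P fun a => expect (Q a) f := by
  unfold expect
  simp_rw [PMF.bind_apply, ← ENNReal.tsum_mul_right, ← ENNReal.tsum_mul_left]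
  rw [ENNReal.tsum_comm]
  simp_rw [mul_assoc]

lemma expect_mono {P : PMF α} {f g : α → ℝ≥0∞} (h : ∀ a, f a ≤ g a) :
    expect P f ≤ expect P g :=
  ENNReal.tsum_le_tsum fun a => mul_le_mul_right (h a) _

lemma expect_add (P : PMF α) (f g : α → ℝ≥0∞) :
    expect P (fun a => f a + g a) = expect P f + expect P g := by
  simp_rw [expect, mul_add, ENNReal.tsum_add]

lemma expect_const_mul (P : PMF α) (c : ℝ≥0∞) (f : α → ℝ≥0∞) :
    expect P (fun a => c * f a) = c * expect P f := by
  simp_rw [expect, ← ENNReal.tsum_mul_left, mul_left_comm]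

lemma expect_mul_const (P : PMF α) (f : α → ℝ≥0∞) (c : ℝ≥0∞) :
    expect P (fun a => f a * c) = expect P f * c := by
  simp_rw [mul_comm _ c, expect_const_mul]

lemma expect_const (P : PMF α) (c : ℝ≥0∞) : expect P (fun _ => c) = c := by
  simp [expect, ENNReal.tsum_mul_right]

lemma expect_sum {ι : Type*} (s : Finset ι) (P : PMF α) (f : ι → α → ℝ≥0∞) :
    expect P (fun a => ∑ i ∈ s, f i a) = ∑ i ∈ s, expect P (f i) := by
  simp_rw [expect, Finset.mul_sum]
  exact Summable.tsum_finsetSum fun _ _ => ENNReal.summable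

lemma expect_comm (P : PMF α) (Q : PMF γ) (f : α → γ → ℝ≥0∞) :
    expect P (fun a => expect Q fun c => f a c) = expect Q fun c => expect P fun a => f a c := by
  simp_rw [expect, ← ENNReal.tsum_mul_left]
  rw [ENNReal.tsum_comm]
  simp_rw [mul_left_comm]

lemma expect_uniform [Fintype α] [Nonempty α] (f : α → ℝ≥0∞) :
    expect (PMF.uniformOfFintype α) f = (Fintype.card α : ℝ≥0∞)⁻¹ * ∑ a, f a := by
  simp [expect, tsum_fintype, Finset.mul_sum]

lemma expect_coin (p : ℝ) (h0 : 0 ≤ p) (h1 : p ≤ 1) (f : Bool → ℝ≥0∞) :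
    expect (coin p h0 h1) f = ENNReal.ofReal p * f true + ENNReal.ofReal (1 - p) * f false := by
  simp [expect, coin]

lemma toOuterMeasure_eq_expect (P : PMF α) (S : Set α) :
    P.toOuterMeasure S = expect P (S.indicator 1) := by
  classical
  rw [PMF.toOuterMeasure_apply, expect]
  refine tsum_congr fun a => ?_
  by_cases h : a ∈ S <;> simp [h]

/-- Markov's inequality in exponential form. -/
lemma toOuterMeasure_le_of_exp (P : PMF α) (X : α → ℝ) (t c : ℝ)
    (h : expect P (fun a => ENNReal.ofReal (Real.exp (X a))) ≤ ENNReal.ofReal (Real.exp c)) :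
    P.toOuterMeasure {a | t ≤ X a} ≤ ENNReal.ofReal (Real.exp (c - t)) := by
  rw [toOuterMeasure_eq_expect]
  calc expect P ({a | t ≤ X a}.indicator 1)
      ≤ expect P fun a => ENNReal.ofReal (Real.exp (X a)) * ENNReal.ofReal (Real.exp (-t)) := by
        refine expect_mono fun a => ?_
        rw [← ENNReal.ofReal_mul (Real.exp_pos _).le, ← Real.exp_add]
        by_cases ha : t ≤ X a
        · simp only [Set.indicator, Set.mem_ofPred_eq, ha, if_true, Pi.one_apply]
          rw [← ENNReal.ofReal_one]
          exact ENNReal.ofReal_le_ofReal (Real.one_le_exp (by linarith))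
        · simp [Set.indicator, ha]
    _ = expect P (fun a => ENNReal.ofReal (Real.exp (X a))) * ENNReal.ofReal (Real.exp (-t)) :=
        expect_mul_const _ _ _
    _ ≤ ENNReal.ofReal (Real.exp c) * ENNReal.ofReal (Real.exp (-t)) := by gcongr
    _ = ENNReal.ofReal (Real.exp (c - t)) := by
        rw [← ENNReal.ofReal_mul (Real.exp_pos _).le, ← Real.exp_add, sub_eq_add_neg]

end Expect

/-! ### Independent sums of multisets -/

section Sums

variable {M : Type*}

/-- The sum of `k` independent multisets with law `W`. -/
def iidSum (W : PMF (Multiset M)) : ℕ → PMF (Multiset M)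
  | 0 => PMF.pure 0
  | k + 1 => W.bind fun S => (iidSum W k).bind fun T => PMF.pure (S + T)

lemma expect_iidSum_zero (W : PMF (Multiset M)) (f : Multiset M → ℝ≥0∞) :
    expect (iidSum W 0) f = f 0 := expect_pure _ _

lemma expect_iidSum_succ (W : PMF (Multiset M)) (k : ℕ) (f : Multiset M → ℝ≥0∞) :
    expect (iidSum W (k + 1)) f = expect W fun S => expect (iidSum W k) fun T => f (S + T) := by
  simp [iidSum, expect_bind, expect_pure]

/-- Independence turns a multiplicative functional into a product; it is applied to the exponential
of a match count. -/
lemma expect_iidSum_mul (W : PMF (Multiset M)) (k : ℕ) (φ : Multiset M → ℝ≥0∞)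
    (h0 : φ 0 = 1) (hφ : ∀ S T, φ (S + T) = φ S * φ T) :
    expect (iidSum W k) φ = expect W φ ^ k := by
  induction k with
  | zero => simp [expect_iidSum_zero, h0]
  | succ k ih =>
    simp_rw [expect_iidSum_succ, hφ, expect_const_mul, ih, expect_mul_const, pow_succ']

lemma expect_iidSum_card (W : PMF (Multiset M)) (k : ℕ) :
    expect (iidSum W k) (fun T => (T.card : ℝ≥0∞)) = k * expect W fun T => (T.card : ℝ≥0∞) := by
  induction k with
  | zero => simp [expect_iidSum_zero]
  | succ k ih =>
    simp_rw [expect_iidSum_succ, Multiset.card_add, Nat.cast_add, expect_add, expect_const, ih]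
    simp; ring

end Sums

/-! ### Blanket noise -/

section Blanket

variable {q b : ℕ} [Fact q.Prime] [NeZero b]

lemma expect_blanketNoise_zero (f : Multiset (Message q b) → ℝ≥0∞) :
    expect (blanketNoise q b 0) f = f 0 := expect_pure _ _

lemma expect_blanketNoise_succ (k : ℕ) (f : Multiset (Message q b) → ℝ≥0∞) :
    expect (blanketNoise q b (k + 1)) f =
      expect (PMF.uniformOfFintype (Message q b)) fun m =>
        expect (blanketNoise q b k) fun T => f (m ::ₘ T) := by
  simp [blanketNoise, expect_bind, expect_pure]

lemma expect_blanketNoise_add (j k : ℕ) (f : Multiset (Message q b) → ℝ≥0∞) :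
    expect (blanketNoise q b (j + k)) f =
      expect (blanketNoise q b j) fun S => expect (blanketNoise q b k) fun T => f (S + T) := by
  induction j generalizing f with
  | zero => simp [expect_blanketNoise_zero]
  | succ j ih =>
    rw [show j + 1 + k = j + k + 1 by omega, expect_blanketNoise_succ, expect_blanketNoise_succ]
    simp_rw [ih, Multiset.cons_add]

lemma expect_blanketNoise_mul (k : ℕ) (φ : Multiset (Message q b) → ℝ≥0∞)
    (h0 : φ 0 = 1) (hφ : ∀ S T, φ (S + T) = φ S * φ T) :
    expect (blanketNoise q b k) φ =
      expect (PMF.uniformOfFintype (Message q b)) (fun m => φ {m}) ^ k := by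
  induction k with
  | zero => simp [expect_blanketNoise_zero, h0]
  | succ k ih =>
    simp_rw [expect_blanketNoise_succ, ← Multiset.singleton_add, hφ, expect_const_mul, ih,
      expect_mul_const, pow_succ']

lemma expect_blanketNoise_card (k : ℕ) :
    expect (blanketNoise q b k) (fun T => (T.card : ℝ≥0∞)) = k := by
  induction k with
  | zero => simp [expect_blanketNoise_zero]
  | succ k ih =>
    simp_rw [expect_blanketNoise_succ, Multiset.card_cons, Nat.cast_add, expect_add, ih,
      expect_const]

/-- Size biasing: weighting `k + 1` blanket noises by the multiplicity of `m` amounts to adding `m`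
to `k` blanket noises. -/
lemma expect_blanketNoise_count_mul [DecidableEq (Message q b)] (m : Message q b) (k : ℕ)
    (f : Multiset (Message q b) → ℝ≥0∞) :
    expect (blanketNoise q b (k + 1)) (fun T => (T.count m : ℝ≥0∞) * f T) =
      (k + 1 : ℕ) * ((Fintype.card (Message q b) : ℝ≥0∞)⁻¹ *
        expect (blanketNoise q b k) fun T => f (m ::ₘ T)) := by
  -- Single out the first noise: the multiplicity of `m` is its multiplicity among the others plus
  -- the indicator that the first one is `m`. The induction then collects `k + 1` equal
  -- contributions.
  have split : ∀ k (f : Multiset (Message q b) → ℝ≥0∞),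
      expect (blanketNoise q b (k + 1)) (fun T => (T.count m : ℝ≥0∞) * f T) =
        expect (PMF.uniformOfFintype (Message q b)) (fun m' =>
          expect (blanketNoise q b k) fun T => (T.count m : ℝ≥0∞) * f (m' ::ₘ T)) +
        (Fintype.card (Message q b) : ℝ≥0∞)⁻¹ *
          expect (blanketNoise q b k) fun T => f (m ::ₘ T) := by
    intro k f
    rw [expect_blanketNoise_succ]
    simp_rw [Multiset.count_cons, Nat.cast_add, add_mul, expect_add]
    congr 1
    rw [expect_uniform, Finset.sum_eq_single m]
    · simp
    · intro m' _ h
      simp [h.symm, expect_const]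
    · simp
  induction k generalizing f with
  | zero => simp [split, expect_blanketNoise_zero, expect_const]
  | succ k ih =>
    rw [split, expect_blanketNoise_succ k fun T => f (m ::ₘ T)]
    simp_rw [ih, expect_const_mul, Multiset.cons_swap m]
    push_cast
    ring

/-- Mixtures of blanket noises with a random number of messages. -/
def IsBlanketMixture (W : PMF (Multiset (Message q b))) : Prop :=
  ∃ Q : PMF ℕ, ∀ f, expect W f = expect Q fun k => expect (blanketNoise q b k) f

lemma IsBlanketMixture.iidSum {W : PMF (Multiset (Message q b))} (hW : IsBlanketMixture W)
    (k : ℕ) : IsBlanketMixture (iidSum W k) := by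
  induction k with
  | zero => exact ⟨PMF.pure 0, fun f => by simp [expect_pure, expect_iidSum_zero,
      expect_blanketNoise_zero]⟩
  | succ k ih =>
    obtain ⟨Q, hQ⟩ := hW
    obtain ⟨R, hR⟩ := ih
    refine ⟨Q.bind fun i => R.bind fun j => PMF.pure (i + j), fun f => ?_⟩
    simp_rw [expect_iidSum_succ, expect_bind, expect_pure, expect_blanketNoise_add, hQ, hR]
    congr 1
    funext i
    rw [expect_comm]

end Blanket

/-! ### Collisions of the hash family -/

lemma hash_val {q b : ℕ} [NeZero b] (s : Seed q) (x : ℕ) :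
    ((hash b s x : Fin b) : ℕ) = ((s.1 : ℕ) * x + (s.2 : ℕ)) % q % b := by
  simp [hash]

/-- The values of a seed at two points, as residues modulo `q`. -/
def seedValues {q : ℕ} (x x' : ℕ) (hq : 0 < q) (s : Seed q) : Fin q × Fin q :=
  (⟨((s.1 : ℕ) * x + s.2) % q, Nat.mod_lt _ hq⟩, ⟨((s.1 : ℕ) * x' + s.2) % q, Nat.mod_lt _ hq⟩)

lemma cast_ne_of_mem_Icc {q x x' : ℕ} (hx : x ∈ Finset.Icc 1 q) (hx' : x' ∈ Finset.Icc 1 q)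
    (hne : x ≠ x') : (x : ZMod q) ≠ x' := by
  rw [Finset.mem_Icc] at hx hx'
  intro h
  rw [ZMod.natCast_eq_natCast_iff] at h
  have h1 := (Nat.modEq_iff_dvd.1 h)
  obtain ⟨c, hc⟩ := h1
  have hc0 : c = 0 := by
    by_contra hc0
    rcases lt_or_gt_of_ne hc0 with h2 | h2
    · nlinarith
    · nlinarith
  subst hc0
  omega

/-- An affine map over the field `ZMod q` is determined by its values at two distinct points, and
numbers in `[1, q]` are determined by their residues. -/
lemma seedValues_injective {q x x' : ℕ} [Fact q.Prime] (hq : 0 < q) (hx : x ∈ Finset.Icc 1 q)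
    (hx' : x' ∈ Finset.Icc 1 q) (hne : x ≠ x') : Function.Injective (seedValues x x' hq) := by
  rintro ⟨⟨u, hu⟩, ⟨v, hv⟩⟩ ⟨⟨u', hu'⟩, ⟨v', hv'⟩⟩ h
  simp only [seedValues, Prod.mk.injEq, Fin.mk.injEq] at h
  obtain ⟨h1, h2⟩ := h
  have e1 : (u * x + v : ZMod q) = u' * x + v' := by
    exact_mod_cast (ZMod.natCast_eq_natCast_iff _ _ _).2 h1
  have e2 : (u * x' + v : ZMod q) = u' * x' + v' := by
    exact_mod_cast (ZMod.natCast_eq_natCast_iff _ _ _).2 h2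
  have e3 : ((u : ZMod q) - u') * ((x : ZMod q) - x') = 0 := by linear_combination e1 - e2
  have hxx := sub_ne_zero.2 (cast_ne_of_mem_Icc hx hx' hne)
  have e4 : (u : ZMod q) = u' := sub_eq_zero.1 ((mul_eq_zero.1 e3).resolve_right hxx)
  have e5 : (v : ZMod q) = v' := by
    rw [e4] at e1
    exact add_left_cancel e1
  have hu2 : u ∈ Finset.Icc 1 q := by rw [Finset.mem_Icc] at hu ⊢; omega
  have hu2' : u' ∈ Finset.Icc 1 q := by rw [Finset.mem_Icc] at hu' ⊢; omega
  have r1 : u = u' := by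
    by_contra hh; exact cast_ne_of_mem_Icc hu2 hu2' hh e4
  have r2 : v = v' := by
    by_contra hh; exact cast_ne_of_mem_Icc hv hv' hh e5
  subst r1 r2
  rfl

lemma seedValues_ne {q x x' : ℕ} [Fact q.Prime] (hq : 0 < q) (hx : x ∈ Finset.Icc 1 q)
    (hx' : x' ∈ Finset.Icc 1 q) (hne : x ≠ x') (s : Seed q) :
    (seedValues x x' hq s).1 ≠ (seedValues x x' hq s).2 := by
  obtain ⟨⟨u, hu⟩, ⟨v, hv⟩⟩ := s
  simp only [seedValues, ne_eq, Fin.mk.injEq]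
  intro h
  have e1 : (u * x + v : ZMod q) = u * x' + v := by
    exact_mod_cast (ZMod.natCast_eq_natCast_iff _ _ _).2 h
  have e3 : (u : ZMod q) * ((x : ZMod q) - x') = 0 := by linear_combination e1
  have hxx := sub_ne_zero.2 (cast_ne_of_mem_Icc hx hx' hne)
  have e4 := (mul_eq_zero.1 e3).resolve_right hxx
  rw [ZMod.natCast_eq_zero_iff] at e4
  rw [Finset.mem_Icc] at hu
  have := Nat.le_of_dvd (by omega) e4
  omega

lemma card_seed (q : ℕ) : Fintype.card (Seed q) = (q - 1) * q := by
  simp [Seed, Range1]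

lemma card_filter_mod_eq {q b v : ℕ} (hv : v < b) :
    ((Finset.range q).filter fun y => y % b = v).card = q / b + if v < q % b then 1 else 0 := by
  have h := Nat.count_modEq_card (b := q) (r := b) (by omega) v
  rw [Nat.mod_eq_of_lt hv] at h
  rw [← h, Nat.count_eq_card_filter_range]
  congr 1
  refine Finset.filter_congr fun y _ => ?_
  rw [Nat.ModEq, Nat.mod_eq_of_lt hv]

lemma card_pairs_mod_eq {q b : ℕ} (hb : 0 < b) :
    ((Finset.univ : Finset (Fin q × Fin q)).filter fun p => (p.1 : ℕ) % b = (p.2 : ℕ) % b).card =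
      ∑ v ∈ Finset.range b, (q / b + if v < q % b then 1 else 0) ^ 2 := by
  rw [Finset.card_eq_sum_card_fiberwise (t := Finset.range b) (f := fun p => (p.1 : ℕ) % b)]
  · refine Finset.sum_congr rfl fun v hv => ?_
    rw [Finset.mem_range] at hv
    rw [← card_filter_mod_eq hv, sq, ← Finset.card_product]
    refine Finset.card_bij (fun p _ => ((p.1 : ℕ), (p.2 : ℕ))) ?_ ?_ ?_
    · rintro ⟨y, y'⟩ h
      simp only [Finset.mem_filter, Finset.mem_univ, true_and] at h
      simp only [Finset.mem_product, Finset.mem_filter, Finset.mem_range]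
      have := y.2; have := y'.2
      omega
    · rintro ⟨y, y'⟩ _ ⟨z, z'⟩ _ h
      simpa [Fin.ext_iff] using h
    · rintro ⟨y, y'⟩ h
      simp only [Finset.mem_product, Finset.mem_filter, Finset.mem_range] at h
      refine ⟨(⟨y, h.1.1⟩, ⟨y', h.2.1⟩), ?_, rfl⟩
      simp only [Finset.mem_filter, Finset.mem_univ, true_and]
      omega
  · intro p _
    simp [Nat.mod_lt _ hb]

/-- Seeds correspond to ordered pairs of distinct residues; the summand `q` accounts for the
diagonal pairs, which always agree modulo `b`. -/
lemma card_seed_collision {q b x x' : ℕ} [Fact q.Prime] [NeZero b] (hx : x ∈ Finset.Icc 1 q)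
    (hx' : x' ∈ Finset.Icc 1 q) (hne : x ≠ x') :
    ((Finset.univ : Finset (Seed q)).filter fun s => hash b s x = hash b s x').card + q =
      ((Finset.univ : Finset (Fin q × Fin q)).filter fun p =>
        (p.1 : ℕ) % b = (p.2 : ℕ) % b).card := by
  have hq : 0 < q := (Fact.out : q.Prime).pos
  have hinj := seedValues_injective hq hx hx' hne
  have himg : (Finset.univ : Finset (Seed q)).image (seedValues x x' hq) =
      (Finset.univ : Finset (Fin q)).offDiag := by
    refine Finset.eq_of_subset_of_card_le ?_ ?_
    · intro p hp
      obtain ⟨s, -, rfl⟩ := Finset.mem_image.1 hp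
      simpa using seedValues_ne hq hx hx' hne s
    -- Surjectivity by counting: both sides have `q * q - q` elements.
    · rw [Finset.card_image_of_injective _ hinj, Finset.offDiag_card, Finset.card_univ,
        Finset.card_univ (α := Seed q), card_seed, Fintype.card_fin, Nat.sub_mul, one_mul]
  rw [← Finset.card_image_of_injective _ hinj]
  have h1 : ((Finset.univ : Finset (Seed q)).filter
      fun s => hash b s x = hash b s x').image (seedValues x x' hq) =
      (Finset.univ : Finset (Fin q)).offDiag.filter fun p => (p.1 : ℕ) % b = (p.2 : ℕ) % b := by
    rw [← himg, Finset.filter_image]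
    congr 1
    refine Finset.filter_congr fun s _ => ?_
    rw [Fin.ext_iff, hash_val, hash_val]
    simp [seedValues]
  have h2 : (Finset.univ : Finset (Fin q × Fin q)) =
      Finset.univ.offDiag ∪ (Finset.univ : Finset (Fin q)).diag := by
    ext ⟨a, c⟩
    simp [em']
  rw [h1, h2, Finset.filter_union, Finset.card_union_of_disjoint]
  · congr 1
    rw [Finset.filter_true_of_mem]
    · simp
    · rintro ⟨a, c⟩ h
      rw [Finset.mem_diag] at h
      rw [show a = c from h.2]
  · exact Finset.disjoint_filter_filter (Finset.disjoint_diag_offDiag _).symm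

lemma card_seed_collision_eq_pcol {q b x x' : ℕ} [Fact q.Prime] [NeZero b]
    (hx : x ∈ Finset.Icc 1 q) (hx' : x' ∈ Finset.Icc 1 q) (hne : x ≠ x') :
    (((Finset.univ : Finset (Seed q)).filter fun s => hash b s x = hash b s x').card : ℝ) =
      pcol q b * Fintype.card (Seed q) := by
  have hq := (Fact.out : q.Prime).two_le
  have h := card_seed_collision (b := b) hx hx' hne
  have hb := Nat.pos_of_neZero b
  rw [card_pairs_mod_eq hb] at h
  -- Of the `b` residue classes, `q % b` have size `q / b + 1` and the others have size `q / b`.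
  have h' : ∑ v ∈ Finset.range b, (q / b + if v < q % b then 1 else 0) ^ 2 =
      b * (q / b) ^ 2 + (2 * (q / b) + 1) * (q % b) := by
    have : ∀ v, (q / b + if v < q % b then 1 else 0) ^ 2 =
        (q / b) ^ 2 + (2 * (q / b) + 1) * if v < q % b then 1 else 0 := by
      intro v; split_ifs <;> ring
    simp_rw [this, Finset.sum_add_distrib, ← Finset.mul_sum]
    simp only [Finset.sum_const, Finset.card_range, smul_eq_mul, Finset.sum_boole, Nat.cast_id]
    congr 3
    have : (Finset.range b).filter (· < q % b) = Finset.range (q % b) := by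
      ext v
      have := Nat.mod_lt q hb
      simp only [Finset.mem_filter, Finset.mem_range]
      omega
    rw [this, Finset.card_range]
  rw [h'] at h
  have hr : ((Finset.univ.filter fun s : Seed q => hash b s x = hash b s x').card : ℝ) + q =
      b * ((q / b : ℕ) : ℝ) ^ 2 + (2 * ((q / b : ℕ) : ℝ) + 1) * ((q % b : ℕ) : ℝ) := by
    exact_mod_cast h
  have hd : (b : ℝ) * ((q / b : ℕ) : ℝ) + ((q % b : ℕ) : ℝ) = q := by
    exact_mod_cast Nat.div_add_mod q b
  have hq' : (2 : ℝ) ≤ q := by exact_mod_cast hq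
  rw [card_seed, Nat.cast_mul, Nat.cast_sub (by omega), Nat.cast_one, pcol, mul_comm (q : ℝ),
    div_mul_cancel₀]
  · linear_combination hr + (((q / b : ℕ) : ℝ) + 1) * hd
  · apply mul_ne_zero <;> linarith

lemma pcol_nonneg {q b : ℕ} (hq : 1 ≤ q) (hb : b ≤ q) : 0 ≤ pcol q b := by
  have h1 : (1 : ℝ) ≤ q := by exact_mod_cast hq
  have h2 : (b : ℝ) ≤ q := by exact_mod_cast hb
  refine div_nonneg (mul_nonneg (Nat.cast_nonneg _) ?_) (mul_nonneg (by linarith) (by linarith))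
  have : (0 : ℝ) ≤ ((q % b : ℕ) : ℝ) := Nat.cast_nonneg _
  linarith

lemma pcol_le {q b : ℕ} (hq : 2 ≤ q) (hb : 1 ≤ b) : pcol q b ≤ 1 / b := by
  have h1 : (2 : ℝ) ≤ q := by exact_mod_cast hq
  have h2 : (1 : ℝ) ≤ b := by exact_mod_cast hb
  have h3 : (((q % b : ℕ) : ℝ)) + 1 ≤ b := by exact_mod_cast Nat.mod_lt q hb
  have hd : (b : ℝ) * ((q / b : ℕ) : ℝ) + ((q % b : ℕ) : ℝ) = q := by
    exact_mod_cast Nat.div_add_mod q b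
  have h4 : (0 : ℝ) ≤ ((q % b : ℕ) : ℝ) := Nat.cast_nonneg _
  have h5 : (0 : ℝ) ≤ ((q / b : ℕ) : ℝ) := Nat.cast_nonneg _
  rw [pcol, div_le_div_iff₀ (mul_pos (by linarith) (by linarith)) (by linarith)]
  have h6 : (b : ℝ) * ((q / b : ℕ) : ℝ) ≤ q := by linarith
  calc ((q / b : ℕ) : ℝ) * (((q % b : ℕ) : ℝ) + q - b) * b
      ≤ ((q / b : ℕ) : ℝ) * (q - 1) * b := by
        refine mul_le_mul_of_nonneg_right (mul_le_mul_of_nonneg_left ?_ h5) (by linarith)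
        linarith
    _ = (b * ((q / b : ℕ) : ℝ)) * (q - 1) := by ring
    _ ≤ q * (q - 1) := mul_le_mul_of_nonneg_right h6 (by linarith)
    _ = 1 * (q * (q - 1)) := by ring

/-! ### The law of the received messages -/

section View

variable {n b q : ℕ} {ε δ : ℝ} [Fact q.Prime] [NeZero b]

/-- The blanket noise of one user. -/
def userNoise (n b q : ℕ) (ε δ : ℝ) [Fact q.Prime] [NeZero b] : PMF (Multiset (Message q b)) :=
  (coin (Int.fract (rho n b ε δ)) (Int.fract_nonneg _) (Int.fract_lt_one _).le).bind fun y =>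
    blanketNoise q b (⌊rho n b ε δ⌋₊ + if y then 1 else 0)

/-- The multiset of the real outputs of all users. -/
def realMessages (q b : ℕ) [Fact q.Prime] [NeZero b] {B : ℕ} :
    {k : ℕ} → (Fin k → Range1 B) → PMF (Multiset (Message q b))
  | 0, _ => PMF.pure 0
  | _ + 1, D =>
    (PMF.uniformOfFintype (Seed q)).bind fun s =>
      (realMessages q b (Fin.tail D)).bind fun R => PMF.pure ((s, hash b s (D 0)) ::ₘ R)

lemma expect_realMessages_succ {B k : ℕ} (D : Fin (k + 1) → Range1 B)
    (f : Multiset (Message q b) → ℝ≥0∞) :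
    expect (realMessages q b D) f = expect (PMF.uniformOfFintype (Seed q)) fun s =>
      expect (realMessages q b (Fin.tail D)) fun R => f ((s, hash b s (D 0)) ::ₘ R) := by
  simp [realMessages, expect_bind, expect_pure]

lemma expect_randomizer (x : ℕ) (f : Multiset (Message q b) → ℝ≥0∞) :
    expect (randomizer n b q ε δ x) f = expect (PMF.uniformOfFintype (Seed q)) fun s =>
      expect (userNoise n b q ε δ) fun T => f ((s, hash b s x) ::ₘ T) := by
  simp [randomizer, userNoise, expect_bind, expect_pure]

/-- The multiset union forgets the senders, so true messages and noise can be regrouped into two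
independent multisets, only the first of which depends on the data. -/
lemma expect_view {B k : ℕ} (D : Fin k → Range1 B) (f : Multiset (Message q b) → ℝ≥0∞) :
    expect ((FE1 n B b q ε δ).view D) f = expect (realMessages q b D) fun R =>
      expect (iidSum (userNoise n b q ε δ) k) fun T => f (R + T) := by
  induction k generalizing f with
  | zero => simp [Protocol.view, realMessages, expect_pure, expect_iidSum_zero]
  | succ k ih =>
    rw [Protocol.view, expect_bind, expect_realMessages_succ]
    simp_rw [expect_bind, expect_pure, ih]
    change expect (randomizer n b q ε δ (D 0)) _ = _
    rw [expect_randomizer]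
    simp_rw [expect_iidSum_succ]
    congr 1
    funext s
    rw [expect_comm]
    refine congrArg _ (funext fun R => congrArg _ (funext fun T => congrArg _ (funext fun T' => ?_)))
    congr 1
    rw [Multiset.cons_add, Multiset.cons_add]
    congr 1
    abel

lemma isBlanketMixture_userNoise : IsBlanketMixture (userNoise n b q ε δ) :=
  ⟨(coin (Int.fract (rho n b ε δ)) (Int.fract_nonneg _) (Int.fract_lt_one _).le).map
      fun y => ⌊rho n b ε δ⌋₊ + if y then 1 else 0, fun f => by
    simp [userNoise, PMF.map, expect_bind, expect_pure]⟩

/-- `Q` is the law of the true messages of the users other than `i`. It is chosen before `D'`, hence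
serves both neighbouring datasets. -/
lemma exists_realMessages_eq {B k : ℕ} (D : Fin k → Range1 B) (i : Fin k) :
    ∃ Q : PMF (Multiset (Message q b)), ∀ D' : Fin k → Range1 B, (∀ j, j ≠ i → D j = D' j) →
      ∀ f, expect (realMessages q b D') f = expect Q fun R =>
        expect (PMF.uniformOfFintype (Seed q)) fun s => f ((s, hash b s (D' i)) ::ₘ R) := by
  induction k with
  | zero => exact i.elim0
  | succ k ih =>
    refine Fin.cases ?_ (fun i => ?_) i
    · refine ⟨realMessages q b (Fin.tail D), fun D' h f => ?_⟩
      have : Fin.tail D = Fin.tail D' := funext fun j => h _ (Fin.succ_ne_zero j)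
      rw [expect_realMessages_succ, this, expect_comm]
    · obtain ⟨Q, hQ⟩ := ih (Fin.tail D) i
      refine ⟨(PMF.uniformOfFintype (Seed q)).bind fun s => Q.bind fun R =>
        PMF.pure ((s, hash b s (D 0)) ::ₘ R), fun D' h f => ?_⟩
      have h0 : D 0 = D' 0 := h 0 (Fin.succ_ne_zero i).symm
      have ht : ∀ j, j ≠ i → Fin.tail D j = Fin.tail D' j :=
        fun j hj => h j.succ fun e => hj (Fin.succ_injective _ e)
      simp_rw [expect_realMessages_succ, expect_bind, expect_pure, h0, hQ _ ht]
      refine congrArg _ (funext fun s => congrArg _ (funext fun R => congrArg _ (funext fun s' => ?_)))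
      rw [Multiset.cons_swap]
      rfl

/-! ### Numbers of messages -/

lemma rho_nonneg (hδ : 0 < δ) (hδ1 : δ < 1) : 0 ≤ rho n b ε δ := by
  have : 0 ≤ Real.log (2 / δ) := Real.log_nonneg (by rw [le_div_iff₀ hδ]; linarith)
  unfold rho
  positivity

lemma natFloor_add_fract {r : ℝ} (hr : 0 ≤ r) : (⌊r⌋₊ : ℝ) + Int.fract r = r := by
  rw [natCast_floor_eq_intCast_floor hr, Int.floor_add_fract]

lemma expect_userNoise_card (h : 0 ≤ rho n b ε δ) :
    expect (userNoise n b q ε δ) (fun T => (T.card : ℝ≥0∞)) = ENNReal.ofReal (rho n b ε δ) := by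
  have h0 := Int.fract_nonneg (rho n b ε δ)
  have h1 := Int.fract_lt_one (rho n b ε δ)
  simp_rw [userNoise, expect_bind, expect_blanketNoise_card, expect_coin]
  simp only [if_true, Bool.false_eq_true, if_false, add_zero]
  rw [← ENNReal.ofReal_natCast, ← ENNReal.ofReal_natCast, ← ENNReal.ofReal_mul h0,
    ← ENNReal.ofReal_mul (by linarith), ← ENNReal.ofReal_add (by positivity)
      (mul_nonneg (by linarith) (by positivity))]
  congr 1
  push_cast
  linarith [natFloor_add_fract h]

lemma expectedMessages_eq {B : ℕ} (h : 0 ≤ rho n b ε δ) (x : Range1 B) :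
    (FE1 n B b q ε δ).expectedMessages x = ENNReal.ofReal (1 + rho n b ε δ) := by
  change expect (randomizer n b q ε δ x) _ = _
  simp_rw [expect_randomizer, Multiset.card_cons, Nat.cast_add, expect_add,
    expect_userNoise_card h, expect_const]
  rw [ENNReal.ofReal_add zero_le_one h, add_comm]
  simp

lemma expect_realMessages_card {B k : ℕ} (D : Fin k → Range1 B) :
    expect (realMessages q b D) (fun T => (T.card : ℝ≥0∞)) = k := by
  induction k with
  | zero => simp [realMessages, expect_pure]
  | succ k ih =>
    simp_rw [expect_realMessages_succ, Multiset.card_cons, Nat.cast_add, expect_add, ih,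
      expect_const]

lemma expect_view_card {B k : ℕ} (h : 0 ≤ rho n b ε δ) (D : Fin k → Range1 B) :
    expect ((FE1 n B b q ε δ).view D) (fun T => (T.card : ℝ≥0∞)) =
      ENNReal.ofReal (k * (1 + rho n b ε δ)) := by
  simp_rw [expect_view, Multiset.card_add, Nat.cast_add, expect_add, expect_const,
    expect_realMessages_card, expect_iidSum_card, expect_userNoise_card h]
  rw [mul_add, mul_one, ENNReal.ofReal_add (by positivity) (by positivity),
    ENNReal.ofReal_mul (by positivity), ENNReal.ofReal_natCast]

/-! ### Exponential moments -/

/-- The number of messages in `T` that match `x`. -/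
def matchCount (x : ℕ) (T : Multiset (Message q b)) : ℕ :=
  T.countP fun m => hash b m.1 x = m.2

lemma matchCount_cons (x : ℕ) (m : Message q b) (T : Multiset (Message q b)) :
    matchCount x (m ::ₘ T) = matchCount x T + if hash b m.1 x = m.2 then 1 else 0 := by
  simp [matchCount, Multiset.countP_cons]

/-- The exponential `exp (l * X)` of the number `X` of messages that match `x`. -/
def expMatch (l : ℝ) (x : ℕ) (T : Multiset (Message q b)) : ℝ≥0∞ :=
  ENNReal.ofReal (Real.exp (l * matchCount x T))

lemma expMatch_zero (l : ℝ) (x : ℕ) : expMatch l x (0 : Multiset (Message q b)) = 1 := by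
  simp [expMatch, matchCount]

lemma expMatch_add (l : ℝ) (x : ℕ) (S T : Multiset (Message q b)) :
    expMatch l x (S + T) = expMatch l x S * expMatch l x T := by
  rw [expMatch, expMatch, expMatch, ← ENNReal.ofReal_mul (Real.exp_pos _).le, ← Real.exp_add]
  simp [matchCount, mul_add]

lemma expMatch_singleton (l : ℝ) (x : ℕ) (m : Message q b) :
    expMatch l x {m} =
      ENNReal.ofReal (Real.exp (l * if hash b m.1 x = m.2 then (1 : ℝ) else 0)) := by
  have h := matchCount_cons x m 0
  simp only [matchCount, Multiset.countP_zero, zero_add] at h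
  rw [expMatch, matchCount]
  erw [h]
  push_cast
  rfl

lemma expect_uniform_exp_ite {α : Type*} [Fintype α] [Nonempty α] (p : α → Prop)
    [DecidablePred p] (l : ℝ) :
    expect (PMF.uniformOfFintype α)
        (fun a => ENNReal.ofReal (Real.exp (l * if p a then (1 : ℝ) else 0))) =
      ENNReal.ofReal (1 + ((Finset.univ.filter p).card : ℝ) / Fintype.card α *
        (Real.exp l - 1)) := by
  have hc : (0 : ℝ) < Fintype.card α := by exact_mod_cast Fintype.card_pos
  have hs : ∑ a, Real.exp (l * if p a then (1 : ℝ) else 0) =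
      Fintype.card α + ((Finset.univ.filter p).card : ℝ) * (Real.exp l - 1) := by
    have : ∀ a, Real.exp (l * if p a then (1 : ℝ) else 0) =
        1 + (if p a then (1 : ℝ) else 0) * (Real.exp l - 1) := by
      intro a; split_ifs <;> simp
    simp_rw [this, Finset.sum_add_distrib, ← Finset.sum_mul]
    simp
  rw [expect_uniform, ← ENNReal.ofReal_sum_of_nonneg (fun _ _ => (Real.exp_pos _).le), hs,
    ← ENNReal.ofReal_natCast, ← ENNReal.ofReal_inv_of_pos hc, ← ENNReal.ofReal_mul (by positivity)]
  congr 1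
  field_simp

/-- The matching messages form the graph of `s ↦ hash b s x`. -/
lemma card_match (x : ℕ) :
    ((Finset.univ : Finset (Message q b)).filter fun m => hash b m.1 x = m.2).card =
      Fintype.card (Seed q) := by
  rw [← Finset.card_univ]
  symm
  refine Finset.card_bij (fun s _ => (s, hash b s x)) (by simp) (by simp) ?_
  rintro ⟨s, w⟩ h
  simp only [Finset.mem_filter, Finset.mem_univ, true_and] at h
  exact ⟨s, Finset.mem_univ _, by rw [h]⟩

lemma card_match_div (x : ℕ) :
    (((Finset.univ : Finset (Message q b)).filter fun m => hash b m.1 x = m.2).card : ℝ) /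
      Fintype.card (Message q b) = 1 / b := by
  have hc : (Fintype.card (Seed q) : ℝ) ≠ 0 := by exact_mod_cast Fintype.card_ne_zero
  have hb : (b : ℝ) ≠ 0 := by exact_mod_cast NeZero.ne b
  rw [card_match, Fintype.card_prod (Seed q), Fintype.card_fin, Nat.cast_mul]
  field_simp

/-- The bound is the moment of a Poisson variable of mean `ρ / b`. The inequality `1 + c ≤ e^c` is
used for each of the `⌊ρ⌋` certain noises and for the fractional one, whose exponents add up to `ρ
c`. -/
lemma expect_userNoise_expMatch_le (hb : 1 ≤ b) (h : 0 ≤ rho n b ε δ) (l : ℝ) (x : ℕ) :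
    expect (userNoise n b q ε δ) (expMatch l x) ≤
      ENNReal.ofReal (Real.exp (rho n b ε δ / b * (Real.exp l - 1))) := by
  have h0 := Int.fract_nonneg (rho n b ε δ)
  have h1 := (Int.fract_lt_one (rho n b ε δ)).le
  have hb1 : (1 : ℝ) ≤ b := by exact_mod_cast hb
  set c : ℝ := 1 / b * (Real.exp l - 1) with hc
  -- `l` may be negative, for lower tails; `1 / b ≤ 1` keeps the base of the powers nonnegative.
  have hc1 : 0 ≤ 1 + c := by
    have : 1 / (b : ℝ) ≤ 1 := by rw [div_le_one (by linarith)]; exact hb1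
    have h2 : 0 ≤ 1 / (b : ℝ) * Real.exp l := by positivity
    rw [hc, mul_sub]
    linarith
  simp_rw [userNoise, expect_bind, expect_blanketNoise_mul _ _ (expMatch_zero l x)
    (expMatch_add l x), expMatch_singleton, expect_coin, expect_uniform_exp_ite, card_match_div,
    ← hc, ← ENNReal.ofReal_pow hc1]
  rw [← ENNReal.ofReal_mul h0, ← ENNReal.ofReal_mul (by linarith),
    ← ENNReal.ofReal_add (by positivity) (mul_nonneg (by linarith) (by positivity))]
  refine ENNReal.ofReal_le_ofReal ?_
  simp only [if_true, Bool.false_eq_true, if_false, add_zero]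
  set r := rho n b ε δ
  calc Int.fract r * (1 + c) ^ (⌊r⌋₊ + 1) + (1 - Int.fract r) * (1 + c) ^ ⌊r⌋₊
      = (1 + c) ^ ⌊r⌋₊ * (1 + Int.fract r * c) := by ring
    _ ≤ Real.exp c ^ ⌊r⌋₊ * Real.exp (Int.fract r * c) := by
        gcongr
        · nlinarith
        · linarith [Real.add_one_le_exp c]
        · linarith [Real.add_one_le_exp (Int.fract r * c)]
    _ = Real.exp (r / b * (Real.exp l - 1)) := by
        rw [← Real.exp_nat_mul, ← Real.exp_add, ← add_mul, natFloor_add_fract h, hc]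
        congr 1
        ring

lemma expect_noise_expMatch_le (hb : 1 ≤ b) (h : 0 ≤ rho n b ε δ) (l : ℝ) (x k : ℕ) :
    expect (iidSum (userNoise n b q ε δ) k) (expMatch l x) ≤
      ENNReal.ofReal (Real.exp (k * rho n b ε δ / b * (Real.exp l - 1))) := by
  rw [expect_iidSum_mul _ _ _ (expMatch_zero l x) (expMatch_add l x)]
  refine (pow_le_pow_left' (expect_userNoise_expMatch_le hb h l x) k).trans_eq ?_
  rw [← ENNReal.ofReal_pow (Real.exp_pos _).le, ← Real.exp_nat_mul]
  congr 2
  ring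

lemma expect_realMessages_expMatch_le {B k : ℕ} (hB : B ≤ q) (l : ℝ) (x : Range1 B)
    (D : Fin k → Range1 B) :
    expect (realMessages q b D) (expMatch l x) ≤
      ENNReal.ofReal (Real.exp (∑ i, if D i = x then l else pcol q b * (Real.exp l - 1))) := by
  induction k with
  | zero => simp [realMessages, expect_pure, expMatch_zero]
  | succ k ih =>
    rw [expect_realMessages_succ]
    simp_rw [← Multiset.singleton_add, expMatch_add, expect_const_mul, expect_mul_const,
      expMatch_singleton, expect_uniform_exp_ite]
    rw [Fin.sum_univ_succ, Real.exp_add, ENNReal.ofReal_mul (Real.exp_pos _).le]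
    refine mul_le_mul' (ENNReal.ofReal_le_ofReal ?_) (ih (Fin.tail D))
    have hmem : ∀ y : Range1 B, (y : ℕ) ∈ Finset.Icc 1 q := fun y =>
      Finset.Icc_subset_Icc le_rfl hB y.2
    have hc : (Fintype.card (Seed q) : ℝ) ≠ 0 := by exact_mod_cast Fintype.card_ne_zero
    -- A user holding `x` matches for every seed; any other user matches with probability `pcol`.
    split_ifs with he
    · rw [he]
      rw [Finset.filter_true_of_mem (fun _ _ => rfl), Finset.card_univ, div_self hc]
      linarith
    · rw [card_seed_collision_eq_pcol (hmem x) (hmem (D 0)) fun e => he (Subtype.ext e.symm),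
        mul_div_cancel_right₀ _ hc]
      linarith [Real.add_one_le_exp (pcol q b * (Real.exp l - 1))]

lemma trueFreq_eq_sum {X : Type*} [DecidableEq X] (D : Fin n → X) (x : X) :
    (trueFreq D x : ℝ) = ∑ i, if D i = x then (1 : ℝ) else 0 := by
  rw [trueFreq, Nat.card_eq_fintype_card, Fintype.card_subtype]
  simp

lemma expect_view_expMatch_le {B : ℕ} (hb : 1 ≤ b) (hB : B ≤ q) (h : 0 ≤ rho n b ε δ) (l : ℝ)
    (x : Range1 B) (D : Fin n → Range1 B) :
    expect ((FE1 n B b q ε δ).view D) (expMatch l x) ≤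
      ENNReal.ofReal (Real.exp (l * trueFreq D x +
        ((n - trueFreq D x) * pcol q b + n * rho n b ε δ / b) * (Real.exp l - 1))) := by
  simp_rw [expect_view, expMatch_add, expect_const_mul, expect_mul_const]
  refine (mul_le_mul' (expect_realMessages_expMatch_le hB l x D)
    (expect_noise_expMatch_le hb h l x n)).trans_eq ?_
  rw [← ENNReal.ofReal_mul (Real.exp_pos _).le, ← Real.exp_add]
  congr 2
  have : ∑ i, (if D i = x then l else pcol q b * (Real.exp l - 1)) =
      l * trueFreq D x + (n - trueFreq D x) * (pcol q b * (Real.exp l - 1)) := by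
    have h1 : ∀ i, (if D i = x then l else pcol q b * (Real.exp l - 1)) =
        pcol q b * (Real.exp l - 1) +
          (if D i = x then (1 : ℝ) else 0) * (l - pcol q b * (Real.exp l - 1)) := by
      intro i; split_ifs <;> ring
    simp_rw [h1, Finset.sum_add_distrib, ← Finset.sum_mul, ← trueFreq_eq_sum]
    simp
    ring
  rw [this]
  ring

end View

/-! ### Tail bounds -/

section Tail

variable {n b q : ℕ} {ε δ : ℝ} [Fact q.Prime] [NeZero b]

lemma exp_neg_le_quadratic {a : ℝ} (ha : 0 ≤ a) : Real.exp (-a) ≤ 1 - a + a ^ 2 / 2 := by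
  have h := Real.quadratic_le_exp_of_nonneg ha
  have h1 : 1 ≤ (1 - a + a ^ 2 / 2) * Real.exp a := by
    have h0 : 0 ≤ 1 - a + a ^ 2 / 2 := by nlinarith [sq_nonneg (a - 1)]
    -- The product is `1 + a ^ 4 / 4`.
    calc (1 : ℝ) ≤ (1 - a + a ^ 2 / 2) * (1 + a + a ^ 2 / 2) := by nlinarith [sq_nonneg (a ^ 2)]
      _ ≤ _ := by gcongr
  rw [Real.exp_neg, inv_eq_one_div, div_le_iff₀ (Real.exp_pos a)]
  exact h1

lemma exp_sub_one_le {l : ℝ} (h : |l| ≤ 1) : Real.exp l - 1 ≤ l + l ^ 2 := by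
  have := (abs_le.1 (Real.abs_exp_sub_one_sub_id_le h)).2
  linarith

/-- Chernoff bound for the number of matches, in terms of a bound on its exponential moment. -/
lemma toOuterMeasure_matchCount_le (P : PMF (Multiset (Message q b))) (x : ℕ) (l t c : ℝ)
    (h : expect P (expMatch l x) ≤ ENNReal.ofReal (Real.exp c)) :
    P.toOuterMeasure {T | l * t ≤ l * matchCount x T} ≤ ENNReal.ofReal (Real.exp (c - l * t)) :=
  toOuterMeasure_le_of_exp P (fun T => l * matchCount x T) _ _ h

end Tail

/-! ### Privacy -/

section Privacy

variable {n b q : ℕ} {ε δ : ℝ} [Fact q.Prime] [NeZero b]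

/-- Writing the match count as a sum of multiplicities of single messages makes size biasing
applicable. -/
lemma matchCount_eq_sum_count [DecidableEq (Message q b)] (x : ℕ) (T : Multiset (Message q b)) :
    matchCount x T = ∑ s : Seed q, T.count (s, hash b s x) := by
  induction T using Multiset.induction_on with
  | empty => simp [matchCount]
  | cons m T ih =>
    simp_rw [matchCount_cons, Multiset.count_cons, Finset.sum_add_distrib, ih]
    congr 1
    rw [Finset.sum_eq_single m.1]
    · simp [Prod.ext_iff]
    · intro s _ hs
      simp [Prod.ext_iff, hs]
    · simp

lemma expect_real_add_blanketNoise (x k : ℕ) (f : Multiset (Message q b) → ℝ≥0∞) :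
    ((k + 1 : ℕ) : ℝ≥0∞) * expect (PMF.uniformOfFintype (Seed q)) (fun s =>
        expect (blanketNoise q b k) fun T => f ((s, hash b s x) ::ₘ T)) =
      b * expect (blanketNoise q b (k + 1)) fun T => (matchCount x T : ℝ≥0∞) * f T := by
  classical
  simp_rw [matchCount_eq_sum_count, Nat.cast_sum, Finset.sum_mul, expect_sum,
    expect_blanketNoise_count_mul, expect_uniform, ← Finset.mul_sum]
  have hb : (b : ℝ≥0∞) ≠ 0 := by exact_mod_cast NeZero.ne b
  rw [Fintype.card_prod (Seed q), Fintype.card_fin, Nat.cast_mul,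
    ENNReal.mul_inv (Or.inr (by simp)) (Or.inr hb)]
  calc _ = ((b : ℝ≥0∞) * (b : ℝ≥0∞)⁻¹) * _ := by
        rw [ENNReal.mul_inv_cancel hb (by simp), one_mul]
    _ = _ := by ring

/-- For each number `k` of noises the densities for `x` and `x'` carry the same factor `b / (k +
1)`, so a pointwise comparison of match counts suffices. -/
lemma expect_real_add_mixture_le {W : PMF (Multiset (Message q b))} (hW : IsBlanketMixture W)
    {x x' : ℕ} {c : ℝ≥0∞} {f : Multiset (Message q b) → ℝ≥0∞}
    (hf : ∀ T, (matchCount x T : ℝ≥0∞) * f T ≤ c * ((matchCount x' T : ℝ≥0∞) * f T)) :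
    expect (PMF.uniformOfFintype (Seed q)) (fun s => expect W fun T => f ((s, hash b s x) ::ₘ T)) ≤
      c * expect (PMF.uniformOfFintype (Seed q)) (fun s =>
        expect W fun T => f ((s, hash b s x') ::ₘ T)) := by
  obtain ⟨Q, hQ⟩ := hW
  simp_rw [hQ]
  rw [expect_comm, expect_comm _ Q, ← expect_const_mul]
  refine expect_mono fun k => ?_
  rw [← ENNReal.mul_le_mul_iff_right (a := ((k + 1 : ℕ) : ℝ≥0∞)) (by positivity) (by simp),
    mul_left_comm, expect_real_add_blanketNoise, expect_real_add_blanketNoise, mul_left_comm,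
    ← expect_const_mul _ c]
  exact mul_le_mul_right (expect_mono hf) _

lemma exp_mul_one_sub_ge (h0 : 0 < ε) (h3 : ε ≤ 3) :
    1 + 3 * ε / 4 ≤ Real.exp ε * (1 - ε / 4) := by
  have h := Real.sum_le_exp_of_nonneg h0.le 4
  simp [Finset.sum_range_succ, Nat.factorial] at h
  calc 1 + 3 * ε / 4 ≤ (1 + ε + ε ^ 2 / 2 + ε ^ 3 / 6) * (1 - ε / 4) := by
        -- This is 24 times the difference of the two sides, and the place where `ε ≤ 3` is
        -- essential.
        have : 0 ≤ ε ^ 2 * ((3 - ε) * (2 + ε)) :=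
          mul_nonneg (sq_nonneg _) (mul_nonneg (by linarith) (by linarith))
        nlinarith
    _ ≤ _ := mul_le_mul_of_nonneg_right (by linarith) (by linarith)

lemma noise_mean (hn : 1 ≤ n) (hb : 1 ≤ b) :
    n * rho n b ε δ / b = 32 * Real.log (2 / δ) / ε ^ 2 := by
  have h1 : (n : ℝ) ≠ 0 := by positivity
  have h2 : (b : ℝ) ≠ 0 := by positivity
  rw [rho]
  field_simp

lemma log_two_div_gt (hδ : 0 < δ) (hδ1 : δ < 1) : 0.69 < Real.log (2 / δ) := by
  have h1 : Real.log 2 ≤ Real.log (2 / δ) :=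
    Real.log_le_log (by norm_num) (by rw [le_div_iff₀ hδ]; linarith)
  have := Real.log_two_gt_d9
  norm_num at this ⊢
  linarith

/-- The `1` stands for the true message, which always matches its own input. Failure forces `X > (1
+ ε / 2) μ` or `X' < (1 - ε / 4) μ`, up to equality, and each tail costs `δ / 2`. -/
lemma noise_imbalance_le (hn : 1 ≤ n) (hb : 1 ≤ b) (h0 : 0 < ε) (h3 : ε ≤ 3) (hδ : 0 < δ)
    (hδ1 : δ < 1) (x x' : ℕ) :
    (iidSum (userNoise n b q ε δ) n).toOuterMeasure
        {T | Real.exp ε * matchCount x' T < 1 + matchCount x T} ≤ ENNReal.ofReal δ := by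
  have hρ : 0 ≤ rho n b ε δ := rho_nonneg hδ hδ1
  set L := Real.log (2 / δ) with hL
  have hLpos : 0.69 < L := log_two_div_gt hδ hδ1
  set μ := 32 * L / ε ^ 2 with hμ
  have hμε : μ * ε ^ 2 = 32 * L := by rw [hμ]; field_simp
  have hμ0 : 0 < μ := by rw [hμ]; norm_num at hLpos; positivity
  -- The gap between `(1 + 3 ε / 4) μ` and `(1 + ε / 2) μ` must absorb the true message. It does,
  -- since `μ ε ^ 2 / 4 = 8 L > 3 ≥ ε`.
  have hμ1 : 1 ≤ μ * (ε / 4) := by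
    have : 1 * ε ≤ μ * (ε / 4) * ε := by norm_num at hLpos; nlinarith
    exact le_of_mul_le_mul_right this h0
  have hexpL : Real.exp (-L) = δ / 2 := by
    rw [hL, Real.exp_neg, Real.exp_log (by positivity), inv_div]
  have hsub : {T : Multiset (Message q b) | Real.exp ε * matchCount x' T < 1 + matchCount x T} ⊆
      {T | (ε / 4) * ((1 + ε / 2) * μ) ≤ (ε / 4) * matchCount x T} ∪
        {T | (-(ε / 4)) * ((1 - ε / 4) * μ) ≤ (-(ε / 4)) * matchCount x' T} := by
    intro T hT
    by_contra hcon
    simp only [Set.mem_union, Set.mem_ofPred_eq, not_or, not_le] at hcon hT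
    obtain ⟨h1, h2⟩ := hcon
    have h1' := lt_of_mul_lt_mul_left h1 (by linarith)
    have h2' : (1 - ε / 4) * μ ≤ matchCount x' T :=
      le_of_mul_le_mul_left (by linarith) (by linarith : 0 < ε / 4)
    have h4 : (1 + 3 * ε / 4) * μ ≤ Real.exp ε * matchCount x' T :=
      calc (1 + 3 * ε / 4) * μ ≤ Real.exp ε * (1 - ε / 4) * μ :=
            mul_le_mul_of_nonneg_right (exp_mul_one_sub_ge h0 h3) hμ0.le
        _ = Real.exp ε * ((1 - ε / 4) * μ) := by ring
        _ ≤ _ := by gcongr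
    linarith
  have hup := toOuterMeasure_matchCount_le (iidSum (userNoise n b q ε δ) n) x (ε / 4)
    ((1 + ε / 2) * μ) _ (expect_noise_expMatch_le hb hρ (ε / 4) x n)
  have hlow := toOuterMeasure_matchCount_le (iidSum (userNoise n b q ε δ) n) x' (-(ε / 4))
    ((1 - ε / 4) * μ) _ (expect_noise_expMatch_le hb hρ (-(ε / 4)) x' n)
  rw [noise_mean hn hb, ← hL, ← hμ] at hup hlow
  have hup' : Real.exp (μ * (Real.exp (ε / 4) - 1) - ε / 4 * ((1 + ε / 2) * μ)) ≤ δ / 2 := by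
    rw [← hexpL, Real.exp_le_exp]
    have := exp_sub_one_le (l := ε / 4) (by rw [abs_of_pos (by linarith)]; linarith)
    have h5 := mul_le_mul_of_nonneg_left this hμ0.le
    nlinarith
  -- The quadratic bound makes the exponent at most `-μ ε ^ 2 / 32 = -L`. This tail dictates the 32
  -- in `rho`; the upper one has exponent at most `-2 L`.
  have hlow' : Real.exp (μ * (Real.exp (-(ε / 4)) - 1) - -(ε / 4) * ((1 - ε / 4) * μ)) ≤
      δ / 2 := by
    rw [← hexpL, Real.exp_le_exp]
    have := exp_neg_le_quadratic (a := ε / 4) (by linarith)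
    have h5 := mul_le_mul_of_nonneg_left this hμ0.le
    nlinarith
  refine (MeasureTheory.measure_mono hsub).trans ((MeasureTheory.measure_union_le _ _).trans ?_)
  calc _ ≤ ENNReal.ofReal (δ / 2) + ENNReal.ofReal (δ / 2) :=
        add_le_add (hup.trans (ENNReal.ofReal_le_ofReal hup'))
          (hlow.trans (ENNReal.ofReal_le_ofReal hlow'))
    _ = ENNReal.ofReal δ := by
        rw [← ENNReal.ofReal_add (by linarith) (by linarith), add_halves]

theorem isDP_FE1 {B : ℕ} (hn : 1 ≤ n) (hb : 1 ≤ b) (h0 : 0 < ε) (h3 : ε ≤ 3) (hδ : 0 < δ)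
    (hδ1 : δ < 1) :
    IsDP (fun D : Fin n → Range1 B => (FE1 n B b q ε δ).view D) ε δ := by
  classical
  rintro D D' ⟨i, hi⟩ S
  obtain ⟨Q, hQ⟩ := exists_realMessages_eq (q := q) (b := b) D i
  simp_rw [toOuterMeasure_eq_expect, expect_view, hQ D (fun _ _ => rfl), hQ D' hi]
  rw [← expect_const_mul]
  -- Condition on the true messages `R` of the other users. They only translate the test set.
  have hpt : ∀ R : Multiset (Message q b),
      expect (PMF.uniformOfFintype (Seed q)) (fun s =>
        expect (iidSum (userNoise n b q ε δ) n) fun T =>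
          S.indicator 1 ((s, hash b s (D i)) ::ₘ R + T)) ≤
      ENNReal.ofReal (Real.exp ε) * expect (PMF.uniformOfFintype (Seed q)) (fun s =>
        expect (iidSum (userNoise n b q ε δ) n) fun T =>
          S.indicator 1 ((s, hash b s (D' i)) ::ₘ R + T)) + ENNReal.ofReal δ := by
    intro R
    set x : ℕ := (D i : ℕ)
    set x' : ℕ := (D' i : ℕ)
    -- On `G` the likelihood ratio is at most `e^ε`; its complement is charged to `δ`.
    set G : Set (Multiset (Message q b)) :=
      {T | (matchCount x T : ℝ) ≤ Real.exp ε * matchCount x' T} with hG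
    set f : Multiset (Message q b) → ℝ≥0∞ := fun T => S.indicator 1 (R + T) with hf
    have hfR : ∀ m T, S.indicator (1 : Multiset (Message q b) → ℝ≥0∞) (m ::ₘ R + T) =
        f (m ::ₘ T) := by
      intro m T
      simp only [hf, Multiset.cons_add, Multiset.add_cons]
    simp_rw [hfR]
    have hf1 : ∀ T, f T ≤ 1 := fun T => Set.indicator_le_self' (fun _ _ => zero_le_one) _
    have hsplit : ∀ T, f T ≤ G.indicator f T + Gᶜ.indicator 1 T := by
      intro T
      by_cases hT : T ∈ G
      · simp [hT]
      · simpa [hT] using hf1 T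
    calc expect (PMF.uniformOfFintype (Seed q)) (fun s =>
          expect (iidSum (userNoise n b q ε δ) n) fun T => f ((s, hash b s x) ::ₘ T))
        ≤ expect (PMF.uniformOfFintype (Seed q)) (fun s =>
            expect (iidSum (userNoise n b q ε δ) n) fun T =>
              G.indicator f ((s, hash b s x) ::ₘ T)) +
          expect (PMF.uniformOfFintype (Seed q)) (fun s =>
            expect (iidSum (userNoise n b q ε δ) n) fun T =>
              Gᶜ.indicator 1 ((s, hash b s x) ::ₘ T)) := by
          simp_rw [← expect_add]
          exact expect_mono fun s => expect_mono fun T => hsplit _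
      _ ≤ ENNReal.ofReal (Real.exp ε) * expect (PMF.uniformOfFintype (Seed q)) (fun s =>
            expect (iidSum (userNoise n b q ε δ) n) fun T =>
              G.indicator f ((s, hash b s x') ::ₘ T)) + ENNReal.ofReal δ := by
          refine add_le_add ?_ ?_
          · refine expect_real_add_mixture_le (isBlanketMixture_userNoise.iidSum n) fun T => ?_
            by_cases hT : T ∈ G
            · rw [← mul_assoc]
              refine mul_le_mul_left ?_ _
              rw [← ENNReal.ofReal_natCast, ← ENNReal.ofReal_natCast (matchCount x' T),
                ← ENNReal.ofReal_mul (Real.exp_pos _).le]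
              exact ENNReal.ofReal_le_ofReal hT
            · simp [hT]
          · refine le_trans ?_ (noise_imbalance_le (q := q) hn hb h0 h3 hδ hδ1 x x')
            rw [toOuterMeasure_eq_expect]
            refine le_trans (expect_mono (g := fun _ => _) fun s =>
              expect_mono fun T => ?_) (expect_const _ _).le
            by_cases hT : (s, hash b s x) ::ₘ T ∈ G
            · simp [hT]
            -- The true message raises the count of `x` by exactly one and cannot lower that of
            -- `x'`, so the failure is already visible in the noise.
            · have hmem : Real.exp ε * matchCount x' T < 1 + matchCount x T := by
                simp only [hG, Set.mem_ofPred_eq, matchCount_cons, if_true, not_le] at hT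
                push_cast at hT
                have h5 : (0 : ℝ) ≤ if hash b s x' = hash b s x then 1 else 0 := by
                  split_ifs <;> norm_num
                have := mul_nonneg (Real.exp_pos ε).le h5
                linarith
              simp [hT, Set.indicator, hmem]
      _ ≤ _ := by
          gcongr
          exact expect_mono fun s => expect_mono fun T => Set.indicator_le_self' (fun _ _ => zero_le) _
  calc _ ≤ _ := expect_mono hpt
    _ = _ := by rw [expect_add, expect_const]

end Privacy

/-! ### Accuracy -/

section Accuracy

variable {n b q : ℕ} {ε δ : ℝ} [Fact q.Prime] [NeZero b]

lemma exists_chernoff_parameter {μ Λ : ℝ} (hμ : 0 ≤ μ) (hΛ : 0 < Λ) :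
    ∃ l : ℝ, 0 < l ∧ l ≤ 1 ∧ μ * l ^ 2 - l * (2 * Λ + 2 * Real.sqrt (μ * Λ)) ≤ -Λ := by
  have hs : 0 < Real.sqrt Λ := Real.sqrt_pos.2 hΛ
  have hm := Real.sqrt_nonneg μ
  have hs2 := Real.sq_sqrt hΛ.le
  have hm2 := Real.sq_sqrt hμ
  rw [Real.sqrt_mul hμ]
  set s := Real.sqrt Λ
  set m := Real.sqrt μ
  have hsm : 0 < s + m := by linarith
  -- The deviation is `2 s (s + m)`, so this `l` makes the linear term exactly `2 Λ`, while `μ l ^ 2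
  -- ≤ Λ`. It stays at most 1, where the quadratic bound on `exp` holds.
  refine ⟨s / (s + m), by positivity, by rw [div_le_one hsm]; linarith, ?_⟩
  have e : μ * (s / (s + m)) ^ 2 - s / (s + m) * (2 * Λ + 2 * (m * s)) =
      (m / (s + m)) ^ 2 * Λ - 2 * Λ := by
    rw [← hs2, ← hm2]
    field_simp
  rw [e]
  have h1 : (m / (s + m)) ^ 2 ≤ 1 := by
    rw [sq_le_one_iff₀ (by positivity), div_le_one hsm]
    linarith
  nlinarith

lemma trueFreq_le {X : Type*} (D : Fin n → X) (x : X) : (trueFreq D x : ℝ) ≤ n := by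
  classical
  rw [trueFreq_eq_sum]
  calc _ ≤ ∑ _i : Fin n, (1 : ℝ) := Finset.sum_le_sum fun i _ => by split_ifs <;> norm_num
    _ = n := by simp

/-- Concentration of the number of matches of a single element. -/
lemma matchCount_deviation_le {B : ℕ} (hb : 1 ≤ b) (hB : B ≤ q) (hbq : b ≤ q)
    (hρ : 0 ≤ rho n b ε δ) {Λ : ℝ} (hΛ : 0 < Λ) (x : Range1 B) (D : Fin n → Range1 B) {μ : ℝ}
    (hμ : μ = (n - trueFreq D x) * pcol q b + n * rho n b ε δ / b) :
    ((FE1 n B b q ε δ).view D).toOuterMeasure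
        {T | 2 * Λ + 2 * Real.sqrt (μ * Λ) < |(matchCount x T : ℝ) - (trueFreq D x + μ)|} ≤
      ENNReal.ofReal (2 * Real.exp (-Λ)) := by
  have hq := (Fact.out : q.Prime).two_le
  have hμ0 : 0 ≤ μ := by
    have h1 := pcol_nonneg (by omega) hbq
    have h2 := sub_nonneg.2 (trueFreq_le D x)
    rw [hμ]
    positivity
  set t := 2 * Λ + 2 * Real.sqrt (μ * Λ)
  obtain ⟨l, hl0, hl1, hl⟩ := exists_chernoff_parameter hμ0 hΛ
  set g : ℝ := (trueFreq D x : ℝ)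
  have hup := toOuterMeasure_matchCount_le ((FE1 n B b q ε δ).view D) x l (g + μ + t) _
    (expect_view_expMatch_le hb hB hρ l x D)
  have hlow := toOuterMeasure_matchCount_le ((FE1 n B b q ε δ).view D) x (-l) (g + μ - t) _
    (expect_view_expMatch_le hb hB hρ (-l) x D)
  rw [← hμ] at hup hlow
  have hup' : Real.exp (l * g + μ * (Real.exp l - 1) - l * (g + μ + t)) ≤ Real.exp (-Λ) := by
    rw [Real.exp_le_exp]
    have := mul_le_mul_of_nonneg_left
      (exp_sub_one_le (l := l) (by rw [abs_of_pos hl0]; exact hl1)) hμ0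
    linarith
  have hlow' : Real.exp (-l * g + μ * (Real.exp (-l) - 1) - -l * (g + μ - t)) ≤
      Real.exp (-Λ) := by
    rw [Real.exp_le_exp]
    have := mul_le_mul_of_nonneg_left
      (exp_sub_one_le (l := -l) (by rw [abs_neg, abs_of_pos hl0]; exact hl1)) hμ0
    linarith
  have hsub : {T : Multiset (Message q b) | t < |(matchCount x T : ℝ) - (g + μ)|} ⊆
      {T | l * (g + μ + t) ≤ l * matchCount x T} ∪
        {T | -l * (g + μ - t) ≤ -l * matchCount x T} := by
    intro T hT
    rcases lt_abs.1 (show t < |(matchCount x T : ℝ) - (g + μ)| from hT) with h | h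
    · exact Or.inl (mul_le_mul_of_nonneg_left (by linarith) hl0.le)
    · refine Or.inr ?_
      change -l * (g + μ - t) ≤ -l * matchCount x T
      exact mul_le_mul_of_nonpos_left (by linarith) (by linarith)
  refine (MeasureTheory.measure_mono hsub).trans ((MeasureTheory.measure_union_le _ _).trans ?_)
  rw [two_mul, ENNReal.ofReal_add (Real.exp_pos _).le (Real.exp_pos _).le]
  exact add_le_add (hup.trans (ENNReal.ofReal_le_ofReal hup'))
    (hlow.trans (ENNReal.ofReal_le_ofReal hlow'))

lemma estimate_sub {B : ℕ} (hp : pcol q b < 1) (D : Fin n → Range1 B) (x : Range1 B)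
    (T : Multiset (Message q b)) :
    estimate n b q ε δ T x - trueFreq D x =
      (matchCount x T - (trueFreq D x +
        ((n - trueFreq D x) * pcol q b + n * rho n b ε δ / b))) / (1 - pcol q b) := by
  have h : 1 - pcol q b ≠ 0 := by linarith
  rw [estimate, eq_div_iff h, sub_mul, div_mul_cancel₀ _ h, matchCount]
  ring

/-- The constant in the bound on the maximum error. -/
def errorConst (β : ℝ) : ℝ := 24 * (1 + Real.log (4 / β))

theorem isAccurate_FE1 {B : ℕ} (hn : 1 ≤ n) (hb : 2 ≤ b) (hbB : 2 * b ≤ B) (hB : B ≤ q)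
    (h0 : 0 < ε) (hδ : 0 < δ) (hδ1 : δ < 1) {β : ℝ} (hβ : 0 < β) (hβ1 : β < 1) :
    IsAccurate (FE1 n B b q ε δ) n
      (errorConst β * (Real.log B +
        Real.sqrt (Real.log B * ((n : ℝ) / b + Real.log (2 / δ) / ε ^ 2)))) β := by
  intro D
  have hq := (Fact.out : q.Prime).two_le
  have hB4 : (4 : ℝ) ≤ B := by exact_mod_cast (by omega : 4 ≤ B)
  have hlogB : 1 ≤ Real.log B := by
    rw [Real.le_log_iff_exp_le (by linarith)]
    linarith [Real.exp_one_lt_d9]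
  have hlogβ : 0 < Real.log (4 / β) := Real.log_pos (by rw [lt_div_iff₀ hβ]; linarith)
  have hL := log_two_div_gt hδ hδ1
  have hL0 : 0 < Real.log (2 / δ) := by norm_num at hL; linarith
  have hb2 : (2 : ℝ) ≤ b := by exact_mod_cast hb
  have hρ : 0 ≤ rho n b ε δ := rho_nonneg hδ hδ1
  have hp0 : 0 ≤ pcol q b := pcol_nonneg (by omega) (by omega)
  have hpb : pcol q b ≤ 1 / b := pcol_le hq (by omega)
  have hp2 : pcol q b ≤ 1 / 2 := hpb.trans (one_div_le_one_div_of_le (by norm_num) hb2)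
  -- The union bound over `B` elements and two tails then totals `β / 2`, leaving room for the
  -- strict inequality.
  set Λ := Real.log (4 * B / β) with hΛdef
  set κ := 1 + Real.log (4 / β) with hκ
  have hΛeq : Λ = Real.log B + Real.log (4 / β) := by
    rw [← Real.log_mul (by linarith) (by positivity), hΛdef]
    congr 1
    ring
  have hΛ : 0 < Λ := by linarith
  have hΛκ : Λ ≤ κ * Real.log B := by nlinarith
  have hκ1 : 1 ≤ κ := by linarith
  set E := (n : ℝ) / b + Real.log (2 / δ) / ε ^ 2 with hE
  have hE0 : 0 ≤ E := by positivity
  set α := errorConst β * (Real.log B + Real.sqrt (Real.log B * E)) with hα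
  have hevent : ∀ x : Range1 B, ((FE1 n B b q ε δ).view D).toOuterMeasure
      {T | α < |estimate n b q ε δ T x - trueFreq D x|} ≤
        ENNReal.ofReal (2 * Real.exp (-Λ)) := by
    intro x
    refine le_trans (MeasureTheory.measure_mono ?_)
      (matchCount_deviation_le (by omega) hB (by omega) hρ hΛ x D rfl)
    intro T hT
    set μ := (n - trueFreq D x) * pcol q b + n * rho n b ε δ / b with hμ
    have hT' : α < |estimate n b q ε δ T x - trueFreq D x| := hT
    change _ < |(matchCount x T : ℝ) - (trueFreq D x + μ)|
    rw [estimate_sub (by linarith), ← hμ, abs_div, abs_of_pos (by linarith : 0 < 1 - pcol q b),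
      lt_div_iff₀ (by linarith)] at hT'
    have hμ32 : μ ≤ 32 * E := by
      have h1 : ((n : ℝ) - trueFreq D x) * pcol q b ≤ n * (1 / b) := by
        gcongr
        have : (0 : ℝ) ≤ trueFreq D x := Nat.cast_nonneg _
        linarith
      have h2 : (0 : ℝ) ≤ (n : ℝ) / b := by positivity
      rw [hμ, noise_mean hn (by omega), hE, mul_add, mul_div_assoc]
      rw [mul_one_div] at h1
      linarith
    have hsqrt : Real.sqrt (μ * Λ) ≤ 6 * κ * Real.sqrt (Real.log B * E) := by
      rw [← Real.sqrt_sq (by positivity : 0 ≤ 6 * κ), ← Real.sqrt_mul (by positivity)]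
      refine Real.sqrt_le_sqrt ?_
      calc μ * Λ ≤ (32 * E) * (κ * Real.log B) := by gcongr
        _ = 32 * κ * (Real.log B * E) := by ring
        _ ≤ (6 * κ) ^ 2 * (Real.log B * E) := by
            refine mul_le_mul_of_nonneg_right ?_ (by positivity)
            nlinarith
    -- The outer 2 pays for dividing by `1 - pcol ≥ 1 / 2`; with the 6 from `hsqrt` this gives the
    -- 24 in `errorConst`.
    have hα2 : 2 * (2 * Λ + 2 * Real.sqrt (μ * Λ)) ≤ α := by
      have : errorConst β = 24 * κ := rfl
      rw [hα, this]
      nlinarith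
    have hα0 : 0 ≤ α := by
      have := Real.sqrt_nonneg (μ * Λ)
      linarith
    nlinarith
  rw [Protocol.output, PMF.toOuterMeasure_map_apply]
  have hsub : (FE1 n B b q ε δ).analyzer ⁻¹' {g | ∃ j, α < |g j - (trueFreq D j : ℝ)|} ⊆
      ⋃ x ∈ (Finset.univ : Finset (Range1 B)),
        {T | α < |estimate n b q ε δ T x - trueFreq D x|} := by
    rintro T ⟨x, hx⟩
    simp only [Finset.mem_univ, Set.iUnion_true, Set.mem_iUnion]
    exact ⟨x, hx⟩
  calc _ ≤ _ := MeasureTheory.measure_mono hsub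
    _ ≤ ∑ x : Range1 B, _ := MeasureTheory.measure_biUnion_finset_le _ _
    _ ≤ ∑ _x : Range1 B, ENNReal.ofReal (2 * Real.exp (-Λ)) :=
        Finset.sum_le_sum fun x _ => hevent x
    _ = ENNReal.ofReal (β / 2) := by
        rw [Finset.sum_const, Finset.card_univ, nsmul_eq_mul, Fintype.card_coe, Nat.card_Icc,
          Nat.add_sub_cancel, ← ENNReal.ofReal_natCast, ← ENNReal.ofReal_mul (by positivity),
          hΛdef, Real.exp_neg, Real.exp_log (by positivity)]
        congr 1
        field_simp
        norm_num
    _ < ENNReal.ofReal β := (ENNReal.ofReal_lt_ofReal_iff hβ).2 (by linarith)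

end Accuracy

/-! ### Message length -/

section Encoding

lemma bitVec_append_inj {m n : ℕ} {x x' : BitVec m} {y y' : BitVec n} (h : x ++ y = x' ++ y') :
    x = x' ∧ y = y' := by
  constructor
  · rw [← BitVec.extractLsb'_append_eq_left (a := x) (b := y), h,
      BitVec.extractLsb'_append_eq_left]
  · rw [← BitVec.extractLsb'_append_eq_right (a := x) (b := y), h,
      BitVec.extractLsb'_append_eq_right]

lemma bitVec_ofNat_inj {w a c : ℕ} (ha : a < 2 ^ w) (hc : c < 2 ^ w)
    (h : BitVec.ofNat w a = BitVec.ofNat w c) : a = c := by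
  have := congrArg BitVec.toNat h
  simpa [Nat.mod_eq_of_lt ha, Nat.mod_eq_of_lt hc] using this

lemma encodeMessage_injective {q b : ℕ} :
    Function.Injective (encodeMessage : Message q b → BitVec _) := by
  rintro ⟨⟨⟨u, hu⟩, ⟨v, hv⟩⟩, w⟩ ⟨⟨⟨u', hu'⟩, ⟨v', hv'⟩⟩, w'⟩ h
  obtain ⟨h1, h2⟩ := bitVec_append_inj h
  obtain ⟨h3, h4⟩ := bitVec_append_inj h1
  -- `v` may equal `q` itself, hence fields of the bit length of `q`.
  have hq := Nat.lt_size_self q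
  have hb := Nat.lt_size_self b
  rw [Finset.mem_Icc] at hu hv hu' hv'
  have e1 := bitVec_ofNat_inj (by simp; omega) (by simp; omega) h3
  have e2 := bitVec_ofNat_inj (by simp; omega) (by simp; omega) h4
  have e3 := bitVec_ofNat_inj (w.2.trans hb) (w'.2.trans hb) h2
  simp only at e1 e2
  subst e1 e2
  rw [Fin.ext e3]

/-- Half of the constant pays for the change of base, as `log 2 > 1 / 2`, and half for the two extra
bits, as `log B ≥ 1`. -/
lemma size_le_log {m B : ℕ} (hB : 4 ≤ B) (hm : m < 2 * B) : (Nat.size m : ℝ) ≤ 4 * Real.log B := by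
  have hB4 : (4 : ℝ) ≤ B := by exact_mod_cast hB
  have h1 : Nat.size m ≤ Nat.log 2 B + 2 := by
    rw [Nat.size_le]
    have := Nat.lt_pow_succ_log_self (b := 2) (by norm_num) B
    rw [pow_succ] at this ⊢
    omega
  have h2 : (Nat.log 2 B : ℝ) ≤ Real.log B / Real.log 2 := by
    have := Real.natLog_le_logb B 2
    rwa [Real.logb] at this
  have hl2 := Real.log_two_gt_d9
  have h3 : 2 * Real.log 2 ≤ Real.log B := by
    rw [← Real.log_rpow (by norm_num)]
    exact Real.log_le_log (by norm_num) (by norm_num; exact hB)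
  have h4 : Real.log B / Real.log 2 ≤ 2 * Real.log B := by
    rw [div_le_iff₀ (by linarith)]
    nlinarith
  have h5 : (Nat.size m : ℝ) ≤ Nat.log 2 B + 2 := by exact_mod_cast h1
  norm_num at hl2
  linarith

lemma messageBits_le {q b B : ℕ} (hB : 4 ≤ B) (hq : q < 2 * B) (hb : b < 2 * B) :
    (messageBits q b : ℝ) ≤ 12 * Real.log B := by
  have h1 := size_le_log hB hq
  have h2 := size_le_log hB hb
  rw [messageBits]
  push_cast
  linarith

end Encoding

/-! ### Total correctness with time bounds -/

/-- `p` started in `σ` halts within `t` steps in a state that satisfies `Q`. -/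
def Runs (w : ℕ) (p : Prog) (σ : State) (t : ℕ) (Q : State → Prop) : Prop :=
  ∃ s τ, s ≤ t ∧ Exec w p σ s τ ∧ Q τ

/-- A nonempty sequence of instructions. -/
def block (c : Instr) : List Instr → Prog
  | [] => .instr c
  | d :: ds => .seq (.instr c) (block d ds)

/-- The effect of a sequence of instructions. -/
def evalBlock (w : ℕ) : List Instr → State → State
  | [], σ => σ
  | c :: cs, σ => evalBlock w cs (c.eval w σ)

section Rules

variable {w : ℕ} {p p₁ p₂ : Prog} {σ : State} {t t₁ t₂ : ℕ} {P Q : State → Prop}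

lemma exec_block (c : Instr) (cs : List Instr) (σ : State) :
    Exec w (block c cs) σ (cs.length + 1) (evalBlock w (c :: cs) σ) := by
  induction cs generalizing c σ with
  | nil => exact .instr c σ
  | cons d ds ih =>
    have h := Exec.seq (.instr c σ) (ih d (c.eval w σ))
    rw [add_comm] at h
    exact h

lemma Runs.block {c : Instr} {cs : List Instr} (ht : cs.length + 1 ≤ t)
    (hQ : Q (evalBlock w (c :: cs) σ)) : Runs w (block c cs) σ t Q :=
  ⟨_, _, ht, exec_block c cs σ, hQ⟩

lemma Runs.seq (h₁ : Runs w p₁ σ t₁ P) (h₂ : ∀ σ', P σ' → Runs w p₂ σ' t₂ Q) :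
    Runs w (.seq p₁ p₂) σ (t₁ + t₂) Q := by
  obtain ⟨s₁, σ₁, hs₁, e₁, hP⟩ := h₁
  obtain ⟨s₂, σ₂, hs₂, e₂, hQ⟩ := h₂ σ₁ hP
  exact ⟨_, _, add_le_add hs₁ hs₂, .seq e₁ e₂, hQ⟩

lemma Runs.mono (h : Runs w p σ t₁ P) (ht : t₁ ≤ t₂) (hPQ : ∀ σ', P σ' → Q σ') :
    Runs w p σ t₂ Q := by
  obtain ⟨s, σ', hs, e, hP⟩ := h
  exact ⟨s, σ', hs.trans ht, e, hPQ _ hP⟩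

/-- Loops with an invariant and a variant. -/
lemma Runs.whileLt {i j c : ℕ} (Inv : State → Prop) (V : State → ℕ)
    (hbody : ∀ σ, Inv σ → σ.int i < σ.int j →
      Runs w p σ c fun σ' => Inv σ' ∧ V σ' < V σ)
    {σ : State} (hσ : Inv σ) :
    Runs w (.whileLt i j p) σ ((c + 1) * V σ + 1)
      fun σ' => Inv σ' ∧ ¬ σ'.int i < σ'.int j := by
  induction hv : V σ using Nat.strong_induction_on generalizing σ with
  | _ v ih =>
    by_cases hlt : σ.int i < σ.int j
    · obtain ⟨s₁, σ₁, hs₁, e₁, hInv, hV⟩ := hbody σ hσ hlt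
      obtain ⟨s₂, σ₂, hs₂, e₂, hQ⟩ := ih (V σ₁) (hv ▸ hV) hInv rfl
      refine ⟨_, _, ?_, .whileTrue hlt e₁ e₂, hQ⟩
      -- Each iteration costs the body and one test; the final failed test is the additional step.
      have h1 : V σ₁ + 1 ≤ v := hv ▸ hV
      have h2 := Nat.mul_le_mul_left (c + 1) h1
      rw [mul_add, mul_one] at h2
      omega
    · exact ⟨1, σ, by omega, .whileFalse hlt, hσ, hlt⟩

lemma runTime_le (h : Runs w p σ t Q) : runTime w p σ ≤ t := by
  obtain ⟨s, σ', hs, e, -⟩ := h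
  exact (iInf₂_le_of_le s σ' (iInf_le _ e)).trans (by exact_mod_cast hs)

end Rules

/-! ### The programs of the analyzer -/

/-- Stores `1` in integer register `8`, and `n ρ / b`, `n p_col` and `1 - p_col` in real registers
`2`, `8` and `11`. -/
def setupProg : Prog :=
  block (.const 8 1) [.const 20 2, .const 21 32,
    .cast 2 20, .rop .div 2 2 1, .rlog 2 2, .cast 3 21, .rop .mul 2 3 2, .rop .mul 4 0 0,
    .rop .div 2 2 4, .cast 5 3, .cast 6 0, .rop .div 7 5 6, .rop .mul 2 2 7,
    .rop .mul 2 6 2, .rop .div 2 2 5,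
    .iop .div 22 2 3, .iop .mod 23 2 3, .cast 8 22, .cast 9 23, .cast 10 2, .rop .add 9 9 10,
    .rop .sub 9 9 5, .rop .mul 8 8 9, .cast 11 8, .rop .sub 12 10 11, .rop .mul 12 10 12,
    .rop .div 8 8 12, .rop .sub 11 11 8, .rop .mul 8 6 8]

/-- What the programs keep in memory throughout: the public parameters, the derived constants and
the received messages. -/
structure Env (n B b q : ℕ) (ε δ : ℝ) (l : List (Message q b)) (σ : State) : Prop where
  int_n : σ.int 0 = n
  int_B : σ.int 1 = B
  int_q : σ.int 2 = q
  int_b : σ.int 3 = b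
  int_N : σ.int 4 = l.length
  int_one : σ.int 8 = 1
  real_noise : σ.real 2 = n * rho n b ε δ / b
  real_col : σ.real 8 = n * pcol q b
  real_den : σ.real 11 = 1 - pcol q b
  arr_u : ∀ i (h : i < l.length), σ.arr 0 i = (l[i].1.1 : ℕ)
  arr_v : ∀ i (h : i < l.length), σ.arr 1 i = (l[i].1.2 : ℕ)
  arr_w : ∀ i (h : i < l.length), σ.arr 2 i = (l[i].2 : ℕ)

/-- The words are long enough for the numbers that occur. -/
structure WordFits (B b q N w : ℕ) : Prop where
  const : 32 < 2 ^ w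
  len : N < 2 ^ w
  sq : 8 * B ^ 2 ≤ 2 ^ w
  four_le : 4 ≤ B
  q_lt : q < 2 * B
  b_le : 2 * b ≤ B

/-- With `s = B + n + N`, four times the bit length gives `2 ^ w ≥ s ^ 4 ≥ 16 s ^ 2`, enough for the
products of two numbers below `2 B` that the programs form. -/
lemma wordFits {n B b q N : ℕ} (hB : 4 ≤ B) (hq : q < 2 * B) (hb : 2 * b ≤ B) :
    WordFits B b q N (wordLength 4 n B N) := by
  have hw : (B + n + N) ^ 4 ≤ 2 ^ wordLength 4 n B N := by
    rw [wordLength, mul_comm, pow_mul]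
    exact Nat.pow_le_pow_left (Nat.lt_size_self _).le 4
  have h4 : 4 ≤ B + n + N := by omega
  set s := B + n + N
  have hs2 : 16 ≤ s ^ 2 := by nlinarith
  have hs4 : 16 * s ^ 2 ≤ s ^ 4 := by
    calc 16 * s ^ 2 ≤ s ^ 2 * s ^ 2 := Nat.mul_le_mul_right _ hs2
      _ = s ^ 4 := by ring
  have hBs : B ^ 2 ≤ s ^ 2 := Nat.pow_le_pow_left (by omega) 2
  have hNs : N ≤ s := by omega
  refine ⟨by omega, ?_, by omega, hB, hq, hb⟩
  nlinarith

/-- Besides the constants, it records the query and the zeros left untouched in memory, from which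
the later loops start counting. -/
lemma runs_setup {n B b q w : ℕ} {ε δ : ℝ} {l : List (Message q b)} {x : ℕ}
    (hw : WordFits B b q l.length w) :
    Runs w setupProg (initState n B b q ε δ l x) 30 fun σ =>
      Env n B b q ε δ l σ ∧ σ.int 5 = x ∧ σ.int 6 = 0 ∧ σ.int 7 = 0 ∧
        (∀ i, σ.arr 4 i = 0) := by
  have h32 := hw.const
  have hq : q < 2 ^ w := by have := hw.sq; have := hw.q_lt; have := hw.four_le; nlinarith
  have m1 : 1 % 2 ^ w = 1 := Nat.mod_eq_of_lt (by omega)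
  have m2 : 2 % 2 ^ w = 2 := Nat.mod_eq_of_lt (by omega)
  have m3 : 32 % 2 ^ w = 32 := Nat.mod_eq_of_lt (by omega)
  have m4 : (q / b) % 2 ^ w = q / b := Nat.mod_eq_of_lt ((Nat.div_le_self _ _).trans_lt hq)
  have m5 : (q % b) % 2 ^ w = q % b := Nat.mod_eq_of_lt ((Nat.mod_le _ _).trans_lt hq)
  refine Runs.block (by simp) ⟨⟨?_, ?_, ?_, ?_, ?_, ?_, ?_, ?_, ?_, ?_, ?_, ?_⟩, ?_, ?_, ?_, ?_⟩
  all_goals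
    simp only [evalBlock, Instr.eval, IntOp.eval, RealOp.eval, Function.update_apply, initState]
    simp [m1, m2, m3, m4, m5]
  · simp [rho, sq]
  · simp [pcol]
  · simp [pcol]
  · intro i h
    simp [h]
  · intro i h
    simp [h]
  · intro i h
    simp [h]
  · intro i
    -- A message fills only arrays `0, 1, 2`, so array `4` reads the default 0 even at an index
    -- carrying a message.
    cases l[i]? <;> rfl

lemma Env.of_eq {n B b q : ℕ} {ε δ : ℝ} {l : List (Message q b)} {σ σ' : State}
    (h : Env n B b q ε δ l σ) (h0 : σ'.int 0 = σ.int 0) (h1 : σ'.int 1 = σ.int 1)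
    (h2 : σ'.int 2 = σ.int 2) (h3 : σ'.int 3 = σ.int 3) (h4 : σ'.int 4 = σ.int 4)
    (h8 : σ'.int 8 = σ.int 8) (r2 : σ'.real 2 = σ.real 2) (r8 : σ'.real 8 = σ.real 8)
    (r11 : σ'.real 11 = σ.real 11) (a0 : σ'.arr 0 = σ.arr 0) (a1 : σ'.arr 1 = σ.arr 1)
    (a2 : σ'.arr 2 = σ.arr 2) : Env n B b q ε δ l σ' :=
  ⟨h0.trans h.int_n, h1.trans h.int_B, h2.trans h.int_q, h3.trans h.int_b, h4.trans h.int_N,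
    h8.trans h.int_one, r2.trans h.real_noise, r8.trans h.real_col, r11.trans h.real_den,
    fun i hi => (congrFun a0 i).trans (h.arr_u i hi),
    fun i hi => (congrFun a1 i).trans (h.arr_v i hi),
    fun i hi => (congrFun a2 i).trans (h.arr_w i hi)⟩

/-- Tests whether the message at the index in integer register `6` matches the queried element. -/
def countInstrs : List Instr :=
  [.load 10 1 6, .load 11 2 6, .iop .mul 9 9 5, .iop .add 9 9 10,
    .iop .mod 9 9 2, .iop .mod 9 9 3, .iop .sub 12 9 11, .iop .sub 13 11 9, .iop .add 12 12 13,
    .iop .sub 12 8 12, .iop .add 7 7 12, .iop .add 6 6 8]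

/-- Counts the messages that match the queried element in integer register `7`. -/
def countProg : Prog := .whileLt 6 4 (block (.load 9 0 6) countInstrs)

/-- Turns the count in integer register `7` into the estimate. -/
def estimateInstrs : List Instr :=
  [.rop .sub 3 3 2, .rop .sub 3 3 8, .rop .div 0 3 11]

/-- The program for single queries. -/
def queryProg : Prog := .seq setupProg (.seq countProg (block (.cast 3 7) estimateInstrs))

/-! ### Single queries: testing every message -/

section Query

variable {n B b q w : ℕ} {ε δ : ℝ} [Fact q.Prime] [NeZero b] {l : List (Message q b)}

lemma matchCount_take_succ (x k : ℕ) (hk : k < l.length) :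
    matchCount x (l.take (k + 1) : Multiset (Message q b)) =
      matchCount x (l.take k : Multiset (Message q b)) +
        if hash b l[k].1 x = l[k].2 then 1 else 0 := by
  rw [List.take_succ_eq_append_getElem hk, ← Multiset.coe_add, matchCount, matchCount,
    Multiset.countP_add]
  congr 1
  exact (matchCount_cons x l[k] 0).trans (by simp [matchCount])

lemma matchCount_take_le (x k : ℕ) :
    matchCount x (l.take k : Multiset (Message q b)) ≤ k :=
  (Multiset.countP_le_card _ _).trans (by simp)

lemma seed_mul_add_lt (s : Seed q) {x : ℕ} (hx : x ≤ B) (hq : q < 2 * B) (hB : 4 ≤ B) :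
    (s.1 : ℕ) * x + (s.2 : ℕ) < 8 * B ^ 2 := by
  have hu := (Finset.mem_Icc.1 s.1.2).2
  have hv := (Finset.mem_Icc.1 s.2.2).2
  have h1 : (s.1 : ℕ) * x ≤ 2 * B * B := Nat.mul_le_mul (by omega) hx
  nlinarith

lemma runs_count (hw : WordFits B b q l.length w) {x : ℕ} (hx : x ≤ B) {σ : State}
    (h : Env n B b q ε δ l σ) (h5 : σ.int 5 = x) (h6 : σ.int 6 = 0) (h7 : σ.int 7 = 0) :
    Runs w countProg σ (14 * l.length + 1) fun σ' =>
      Env n B b q ε δ l σ' ∧ σ'.int 7 = matchCount x (l : Multiset (Message q b)) := by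
  have key := Runs.whileLt (w := w) (i := 6) (j := 4) (c := 13)
    (p := block (.load 9 0 6) countInstrs)
    (fun σ => Env n B b q ε δ l σ ∧ σ.int 5 = x ∧ σ.int 6 ≤ l.length ∧
      σ.int 7 = matchCount x (l.take (σ.int 6) : Multiset (Message q b)))
    (fun σ => l.length - σ.int 6) ?_ (σ := σ) ⟨h, h5, by omega, by rw [h6, h7]; simp [matchCount]⟩
  · refine key.mono (by rw [h6]; omega) ?_
    rintro σ' ⟨⟨hE, -, hle, hc⟩, hlt⟩
    rw [hE.int_N] at hlt
    rw [show σ'.int 6 = l.length by omega, List.take_length] at hc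
    exact ⟨hE, hc⟩
  · rintro σ ⟨hE, h5, hle, hc⟩ hlt
    rw [hE.int_N] at hlt
    set k := σ.int 6 with hk
    have hlen := hw.len
    have hsq := hw.sq
    have hB := hw.four_le
    have hql := hw.q_lt
    have hbound := seed_mul_add_lt l[k].1 hx hql hB
    have hbB := hw.b_le
    have hBw : B < 2 ^ w := by nlinarith
    have hcle := matchCount_take_le (l := l) x k
    have hqw : q < 2 ^ w := by nlinarith
    have hq0 := (Fact.out : q.Prime).pos
    have hb0 := Nat.pos_of_neZero b
    have hwb := l[k].2.2
    have hu := hE.arr_u k hlt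
    have hv := hE.arr_v k hlt
    have hw' := hE.arr_w k hlt
    set u : ℕ := (l[k].1.1 : ℕ)
    set v : ℕ := (l[k].1.2 : ℕ)
    have e1 : u * x % 2 ^ w = u * x := Nat.mod_eq_of_lt (by omega)
    have e2 : (u * x + v) % 2 ^ w = u * x + v := Nat.mod_eq_of_lt (by omega)
    have e3 : (u * x + v) % q % 2 ^ w = (u * x + v) % q :=
      Nat.mod_eq_of_lt ((Nat.mod_lt _ hq0).trans hqw)
    have e4 : (u * x + v) % q % b % 2 ^ w = (u * x + v) % q % b :=
      Nat.mod_eq_of_lt (((Nat.mod_le _ _).trans_lt (Nat.mod_lt _ hq0)).trans hqw)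
    have hz : (u * x + v) % q % b ≤ (u * x + v) % q := Nat.mod_le _ _
    have hz2 : (u * x + v) % q < 2 ^ w := (Nat.mod_lt _ hq0).trans hqw
    have hhash : ((hash b l[k].1 x : Fin b) : ℕ) = (u * x + v) % q % b := hash_val _ _
    set z := (u * x + v) % q % b
    set y : ℕ := (l[k].2 : ℕ)
    refine Runs.block (by simp [countInstrs]) ⟨⟨?_, ?_, ?_, ?_⟩, ?_⟩
    · exact hE.of_eq rfl rfl rfl rfl rfl rfl rfl rfl rfl rfl rfl rfl
    · exact h5
    all_goals
      have h6' : (evalBlock w (.load 9 0 6 :: countInstrs) σ).int 6 = k + 1 := by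
        change (σ.int 6 + σ.int 8) % 2 ^ w = k + 1
        rw [hE.int_one, ← hk]
        exact Nat.mod_eq_of_lt (by omega)
      rw [h6']
    · omega
    · rw [matchCount_take_succ _ _ hlt]
      simp only [Fin.ext_iff, hhash]
      -- An equality test without branching: with truncated subtraction `(z - y) + (y - z)` vanishes
      -- exactly when `z = y`, so `1` minus it is the indicator of a match.
      change (σ.int 7 + (σ.int 8 - (((((σ.arr 0 k * σ.int 5 % 2 ^ w + σ.arr 1 k) % 2 ^ w) %
        σ.int 2 % 2 ^ w) % σ.int 3 % 2 ^ w - σ.arr 2 k) % 2 ^ w + (σ.arr 2 k -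
        ((((σ.arr 0 k * σ.int 5 % 2 ^ w + σ.arr 1 k) % 2 ^ w) %
        σ.int 2 % 2 ^ w) % σ.int 3 % 2 ^ w)) % 2 ^ w) % 2 ^ w) % 2 ^ w) % 2 ^ w =
          _ + if z = y then 1 else 0
      rw [h5, hE.int_q, hE.int_b, hE.int_one, hu, hv, hw', hc, e1, e2, e3, e4,
        Nat.mod_eq_of_lt (by omega : z - y < 2 ^ w), Nat.mod_eq_of_lt (by omega : y - z < 2 ^ w),
        Nat.mod_eq_of_lt (by omega : z - y + (y - z) < 2 ^ w)]
      split_ifs with hzy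
      · rw [hzy, Nat.sub_self, Nat.add_zero, Nat.sub_zero,
          Nat.mod_eq_of_lt (by omega : 1 < 2 ^ w), Nat.mod_eq_of_lt (by omega)]
      · rw [show 1 - (z - y + (y - z)) = 0 by omega, Nat.zero_mod, Nat.mod_eq_of_lt (by omega)]
    · omega

lemma runs_estimate {x : ℕ} {T : Multiset (Message q b)} {σ : State}
    (h : Env n B b q ε δ l σ) (h7 : σ.int 7 = matchCount x T) :
    Runs w (block (.cast 3 7) estimateInstrs) σ 4 fun σ' =>
      σ'.real 0 = estimate n b q ε δ T x := by
  refine Runs.block (by simp [estimateInstrs]) ?_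
  change ((σ.int 7 : ℝ) - σ.real 2 - σ.real 8) / σ.real 11 = _
  rw [h7, h.real_noise, h.real_col, h.real_den]
  rfl

lemma runs_query (hw : WordFits B b q l.length w) {x : ℕ} (hx : x ≤ B) :
    Runs w queryProg (initState n B b q ε δ l x) (14 * l.length + 35) fun σ =>
      σ.real 0 = estimate n b q ε δ (l : Multiset (Message q b)) x := by
  have h := (runs_setup (n := n) (ε := ε) (δ := δ) (x := x) hw).seq fun σ h =>
    (runs_count hw hx h.1 h.2.1 h.2.2.1 h.2.2.2.1).seq fun σ' h' => runs_estimate h'.1 h'.2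
  exact h.mono (by omega) fun σ h => h

end Query

/-- Computes one entry of the table of inverses. -/
def inverseInstrs : List Instr :=
  [.iop .sub 9 2 9, .iop .mod 10 2 6, .load 10 3 10, .iop .mul 9 9 10, .iop .mod 9 9 2,
    .store 3 6 9, .iop .add 6 6 8]

/-- Tabulates the inverses modulo `q` in integer array `3`, by the recursion
`u⁻¹ = -⌊q / u⌋ (q mod u)⁻¹`. -/
def inverseProg : Prog :=
  .seq (block (.store 3 8 8) [.const 6 2]) (.whileLt 6 2 (block (.iop .div 9 2 6) inverseInstrs))

/-- Increments the counter of the residue whose hash before reduction is integer register `11`. -/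
def scatterInstrs : List Instr :=
  [.iop .mul 13 13 12, .iop .mod 13 13 2, .load 14 4 13, .iop .add 14 14 8, .store 4 13 14,
    .iop .add 11 11 3]

/-- Increments, in integer array `4`, the counters of all residues that the message at the index in
integer register `6` matches. -/
def scatterProg : Prog :=
  .seq (block (.load 9 0 6) [.load 10 1 6, .load 11 2 6, .load 12 3 9, .iop .sub 10 2 10])
    (.seq (.whileLt 11 2 (block (.iop .add 13 11 10) scatterInstrs)) (block (.iop .add 6 6 8) []))

/-- Counts, in integer array `4`, the matches of all residues modulo `q`. -/
def tallyProg : Prog := .seq (block (.const 6 0) []) (.whileLt 6 4 scatterProg)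

/-- Writes the estimate for the element in integer register `6`. -/
def outputInstrs : List Instr :=
  .load 7 4 13 :: .cast 3 7 :: (estimateInstrs ++ [.rstore 0 6 0, .iop .add 6 6 8])

/-- Turns the counters into estimates. -/
def outputProg : Prog :=
  .seq (block (.const 6 1) [.iop .add 15 1 8])
    (.whileLt 6 15 (block (.iop .mod 13 6 2) outputInstrs))

/-- The program for all queries at once. -/
def queryAllProg : Prog := .seq setupProg (.seq inverseProg (.seq tallyProg outputProg))

/-! ### All queries: tabulated inverses and counters for the residues -/

section QueryAll

variable {n B b q w : ℕ} {ε δ : ℝ} [Fact q.Prime] [NeZero b] {l : List (Message q b)}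

/-- The array `a` holds the inverses modulo `q` of the numbers below `m`. -/
def IsInverseTable (q : ℕ) (a : ℕ → ℕ) (m : ℕ) : Prop :=
  ∀ v, 1 ≤ v → v < m → a v < q ∧ ((v : ZMod q) * (a v : ZMod q) = 1)

/-- Modulo `q` one has `u ⌊q / u⌋ + (q mod u) = 0`; multiply by `c`. Using `q - q / u` avoids
negative numbers. -/
lemma inverse_step {u c : ℕ} (hc : ((q % u : ℕ) : ZMod q) * (c : ZMod q) = 1) :
    (u : ZMod q) * (((q - q / u) * c % q : ℕ) : ZMod q) = 1 := by
  have h1 : ((u : ZMod q) * ((q / u : ℕ) : ZMod q) + ((q % u : ℕ) : ZMod q)) = 0 := by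
    rw [← Nat.cast_mul, ← Nat.cast_add, Nat.div_add_mod, ZMod.natCast_self]
  rw [ZMod.natCast_mod, Nat.cast_mul, Nat.cast_sub (Nat.div_le_self _ _), ZMod.natCast_self]
  linear_combination hc - (c : ZMod q) * h1

lemma runs_inverse (hw : WordFits B b q l.length w) {σ : State}
    (h : Env n B b q ε δ l σ) (h4 : ∀ i, σ.arr 4 i = 0) :
    Runs w inverseProg σ (9 * q + 3) fun σ' =>
      Env n B b q ε δ l σ' ∧ IsInverseTable q (σ'.arr 3) q ∧ ∀ i, σ'.arr 4 i = 0 := by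
  have hq2 := (Fact.out : q.Prime).two_le
  have h32 := hw.const
  have hsq := hw.sq
  have hB := hw.four_le
  have hql := hw.q_lt
  have hqq : q * q < 2 ^ w := by nlinarith
  have hqw : q < 2 ^ w := by nlinarith
  let Inv : State → Prop := fun σ => Env n B b q ε δ l σ ∧ 2 ≤ σ.int 6 ∧ σ.int 6 ≤ q ∧
    IsInverseTable q (σ.arr 3) (σ.int 6) ∧ ∀ i, σ.arr 4 i = 0
  have hinit : Runs w (block (.store 3 8 8) [.const 6 2]) σ 2 Inv := by
    have h6 : (evalBlock w [.store 3 8 8, .const 6 2] σ).int 6 = 2 :=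
      Nat.mod_eq_of_lt (by omega : 2 < 2 ^ w)
    refine Runs.block (by simp)
      ⟨h.of_eq rfl rfl rfl rfl rfl rfl rfl rfl rfl rfl rfl rfl, by rw [h6], by rw [h6]; exact hq2,
        ?_, h4⟩
    rw [h6]
    intro v hv1 hv2
    obtain rfl : v = 1 := by omega
    have : (evalBlock w [.store 3 8 8, .const 6 2] σ).arr 3 1 = 1 := by
      change Function.update (σ.arr 3) (σ.int 8) (σ.int 8) 1 = 1
      simp [h.int_one]
    rw [this]
    exact ⟨by omega, by simp⟩
  have hloop : ∀ σ : State, Inv σ →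
      Runs w (.whileLt 6 2 (block (.iop .div 9 2 6) inverseInstrs)) σ (9 * q + 1) fun σ' =>
        Env n B b q ε δ l σ' ∧ IsInverseTable q (σ'.arr 3) q ∧ ∀ i, σ'.arr 4 i = 0 := by
    intro σ hσ
    refine (Runs.whileLt (c := 8) Inv (fun σ => q - σ.int 6) ?_ hσ).mono (by omega) ?_
    · rintro σ ⟨hE, hge, hle, hT, hz⟩ hlt
      rw [hE.int_q] at hlt
      set u := σ.int 6 with hu
      -- `2 ≤ u < q` cannot divide the prime `q`, so the recursion reads an entry that is already
      -- present.
      have hmod0 : 1 ≤ q % u := by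
        rw [Nat.one_le_iff_ne_zero]
        intro h0
        have := (Nat.dvd_prime Fact.out).1 (Nat.dvd_of_mod_eq_zero h0)
        omega
      have hmodu : q % u < u := Nat.mod_lt _ (by omega)
      obtain ⟨hc, hinv⟩ := hT _ hmod0 hmodu
      set c := σ.arr 3 (q % u) with hcdef
      have hmul : (q - q / u) * c < 2 ^ w :=
        (Nat.mul_le_mul (Nat.sub_le _ _) hc.le).trans_lt hqq
      have h6' : (evalBlock w (.iop .div 9 2 6 :: inverseInstrs) σ).int 6 = u + 1 := by
        change (σ.int 6 + σ.int 8) % 2 ^ w = u + 1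
        rw [hE.int_one]
        exact Nat.mod_eq_of_lt (by omega)
      have harr : (evalBlock w (.iop .div 9 2 6 :: inverseInstrs) σ).arr 3 =
          Function.update (σ.arr 3) u ((q - q / u) * c % q) := by
        change Function.update (σ.arr 3) u
          (((σ.int 2 - σ.int 2 / u % 2 ^ w) % 2 ^ w *
            σ.arr 3 (σ.int 2 % u % 2 ^ w)) % 2 ^ w % σ.int 2 % 2 ^ w) = _
        rw [hE.int_q, Nat.mod_eq_of_lt ((Nat.div_le_self q u).trans_lt hqw),
          Nat.mod_eq_of_lt ((Nat.sub_le q _).trans_lt hqw),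
          Nat.mod_eq_of_lt ((Nat.mod_le q u).trans_lt hqw), ← hcdef, Nat.mod_eq_of_lt hmul,
          Nat.mod_eq_of_lt ((Nat.mod_lt _ (by omega)).trans hqw)]
      refine Runs.block (by simp [inverseInstrs])
        ⟨⟨hE.of_eq rfl rfl rfl rfl rfl rfl rfl rfl rfl rfl rfl rfl, ?_, ?_, ?_, hz⟩, ?_⟩
      · rw [h6']; omega
      · rw [h6']; omega
      · rw [h6', harr]
        intro v hv1 hv2
        by_cases hvu : v = u
        · rw [hvu, Function.update_self]
          exact ⟨Nat.mod_lt _ (by omega), inverse_step hinv⟩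
        · rw [Function.update_of_ne hvu]
          exact hT v hv1 (by omega)
      · rw [h6']; omega
    · rintro σ' ⟨⟨hE, -, hle, hT, hz⟩, hlt⟩
      rw [hE.int_q] at hlt
      rw [show σ'.int 6 = q by omega] at hT
      exact ⟨hE, hT, hz⟩
  exact (hinit.seq hloop).mono (by omega) fun _ h => h

lemma mod_eq_iff_cast_eq {a t : ℕ} (ht : t < q) : a % q = t ↔ (a : ZMod q) = t := by
  rw [ZMod.natCast_eq_natCast_iff', Nat.mod_eq_of_lt ht]

/-- Solve `u t + v = y` for `t` in the field, with `c` the inverse of `u`. -/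
lemma scatter_index {u v c t y : ℕ} (hv : v ≤ q) (ht : t < q) (hy : y < q)
    (hc : (u : ZMod q) * (c : ZMod q) = 1) :
    (y + (q - v)) * c % q = t ↔ (u * t + v) % q = y := by
  rw [mod_eq_iff_cast_eq ht, mod_eq_iff_cast_eq hy, Nat.cast_mul, Nat.cast_add, Nat.cast_sub hv,
    ZMod.natCast_self, Nat.cast_add, Nat.cast_mul]
  constructor
  · intro h
    linear_combination (-(u : ZMod q)) * h + ((y : ZMod q) - v) * hc
  · intro h
    linear_combination (-(c : ZMod q)) * h + (t : ZMod q) * hc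

/-- Within one class modulo `b`, raising the threshold from `y` to `y + b` admits just `y`; this is
the effect of one pass of the scatter loop. -/
lemma mod_eq_lt_add_iff {z y m : ℕ} (hy : y % b = m) :
    (z % b = m ∧ z < y + b) ↔ (z % b = m ∧ z < y) ∨ z = y := by
  constructor
  · rintro ⟨h1, h2⟩
    by_cases hzy : z < y
    · exact Or.inl ⟨h1, hzy⟩
    · refine Or.inr ?_
      have h3 : y ≡ z [MOD b] := hy.trans h1.symm
      have h4 := (Nat.modEq_iff_dvd' (by omega)).1 h3
      have := Nat.eq_zero_of_dvd_of_lt h4 (by omega)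
      omega
  · have := Nat.pos_of_neZero b
    rintro (⟨h1, h2⟩ | rfl)
    · exact ⟨h1, by omega⟩
    · exact ⟨hy, by omega⟩

/-- The invariant: the counters raised so far are those of the `t` whose value `(u t + v) mod q` is
congruent to `m` modulo `b` and below register `11`. The hypothesis `hf` keeps the increments from
overflowing. -/
lemma runs_scatter_loop (hw : WordFits B b q l.length w) {s : Seed q} {m c k : ℕ} {f : ℕ → ℕ}
    (hf : ∀ t < q, f t < l.length) (hcq : c < q) (hc : ((s.1 : ℕ) : ZMod q) * (c : ZMod q) = 1)
    (hm : m < b) {σ : State} (h : Env n B b q ε δ l σ) (h6 : σ.int 6 = k)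
    (h10 : σ.int 10 = q - (s.2 : ℕ)) (h11 : σ.int 11 = m) (h12 : σ.int 12 = c)
    (h3 : IsInverseTable q (σ.arr 3) q) (h4 : ∀ t < q, σ.arr 4 t = f t) :
    Runs w (.whileLt 11 2 (block (.iop .add 13 11 10) scatterInstrs)) σ (8 * (q / b + 1) + 1)
      fun σ' => Env n B b q ε δ l σ' ∧ σ'.int 6 = k ∧ IsInverseTable q (σ'.arr 3) q ∧
        ∀ t < q, σ'.arr 4 t = f t + if ((s.1 : ℕ) * t + s.2) % q % b = m then 1 else 0 := by
  have hq0 := (Fact.out : q.Prime).pos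
  have hb0 := Nat.pos_of_neZero b
  have hsq := hw.sq
  have hB := hw.four_le
  have hql := hw.q_lt
  have hbB := hw.b_le
  have hlen := hw.len
  have hv := (Finset.mem_Icc.1 s.2.2)
  have hqq : 2 * q * q < 2 ^ w := by nlinarith
  have hqw : 2 * q < 2 ^ w := by nlinarith
  have hBw : 4 * B < 2 ^ w := by nlinarith
  refine (Runs.whileLt (c := 7)
    (fun σ => Env n B b q ε δ l σ ∧ σ.int 6 = k ∧ σ.int 10 = q - (s.2 : ℕ) ∧ σ.int 12 = c ∧
      IsInverseTable q (σ.arr 3) q ∧ σ.int 11 % b = m ∧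
      ∀ t < q, σ.arr 4 t = f t + if ((s.1 : ℕ) * t + s.2) % q % b = m ∧
        ((s.1 : ℕ) * t + s.2) % q < σ.int 11 then 1 else 0)
    -- The remaining passes number `(q - y) / b` rounded up.
    (fun σ => (q + b - 1 - σ.int 11) / b) ?_ (σ := σ) ?_).mono ?_ ?_
  · rintro σ ⟨hE, h6, h10, h12, h3, hm11, h4⟩ hlt
    rw [hE.int_q] at hlt
    set y := σ.int 11 with hy
    have hprod : (y + (q - (s.2 : ℕ))) * c < 2 ^ w :=
      (Nat.mul_le_mul (by omega : _ ≤ 2 * q) hcq.le).trans_lt hqq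
    set i := (y + (q - (s.2 : ℕ))) * c % q with hi
    have hiq : i < q := Nat.mod_lt _ hq0
    have hidx : (y + (q - (s.2 : ℕ))) % 2 ^ w * c % 2 ^ w % q % 2 ^ w = i := by
      rw [Nat.mod_eq_of_lt (by omega : y + (q - (s.2 : ℕ)) < 2 ^ w), Nat.mod_eq_of_lt hprod,
        ← hi, Nat.mod_eq_of_lt (by omega)]
    have h11' : (evalBlock w (.iop .add 13 11 10 :: scatterInstrs) σ).int 11 = y + b := by
      change (σ.int 11 + σ.int 3) % 2 ^ w = y + b
      rw [hE.int_b]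
      exact Nat.mod_eq_of_lt (by omega)
    have harr : (evalBlock w (.iop .add 13 11 10 :: scatterInstrs) σ).arr 4 =
        Function.update (σ.arr 4) i ((σ.arr 4 i + 1) % 2 ^ w) := by
      change Function.update (σ.arr 4) ((y + σ.int 10) % 2 ^ w * σ.int 12 % 2 ^ w % σ.int 2 % 2 ^ w)
        ((σ.arr 4 ((y + σ.int 10) % 2 ^ w * σ.int 12 % 2 ^ w % σ.int 2 % 2 ^ w) + σ.int 8) %
          2 ^ w) = _
      rw [h10, h12, hE.int_q, hE.int_one, hidx]
    refine Runs.block (by simp [scatterInstrs])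
      ⟨⟨hE.of_eq rfl rfl rfl rfl rfl rfl rfl rfl rfl rfl rfl rfl, h6, h10, h12, h3, ?_, ?_⟩, ?_⟩
    · rw [h11', Nat.add_mod_right, hm11]
    · intro t ht
      have hiff : i = t ↔ ((s.1 : ℕ) * t + s.2) % q = y := scatter_index hv.2 ht hlt hc
      rw [h11', harr]
      simp only [mod_eq_lt_add_iff hm11, ← hiff]
      by_cases hit : t = i
      · subst hit
        have h0 := h4 _ ht
        rw [if_neg] at h0
        · have := hf _ ht
          rw [Function.update_self, h0, if_pos (Or.inr rfl)]
          exact Nat.mod_eq_of_lt (by omega)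
        · rw [hiff.1 rfl]
          omega
      · rw [Function.update_of_ne hit, h4 t ht]
        simp only [Ne.symm hit, or_false]
    · rw [h11', show q + b - 1 - y = (q + b - 1 - (y + b)) + b by omega, Nat.add_div_right _ hb0]
      omega
  · refine ⟨h, h6, h10, h12, h3, by rw [h11]; exact Nat.mod_eq_of_lt hm, fun t ht => ?_⟩
    rw [h4 t ht, h11, if_neg, Nat.add_zero]
    rintro ⟨h1, h2⟩
    -- Initially nothing counts: a number with residue `m` is at least `m`.
    have := Nat.mod_le (((s.1 : ℕ) * t + s.2) % q) b
    omega
  · have : (q + b - 1 - σ.int 11) / b ≤ q / b + 1 := by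
      rw [← Nat.add_div_right _ hb0]
      exact Nat.div_le_div_right (by omega)
    omega
  · rintro σ' ⟨⟨hE, h6, -, -, h3, -, h4⟩, hge⟩
    rw [hE.int_q] at hge
    refine ⟨hE, h6, h3, fun t ht => ?_⟩
    have := Nat.mod_lt ((s.1 : ℕ) * t + s.2) hq0
    rw [h4 t ht]
    simp only [show ((s.1 : ℕ) * t + s.2) % q < σ'.int 11 by omega, and_true]

lemma runs_tally (hw : WordFits B b q l.length w) {σ : State} (h : Env n B b q ε δ l σ)
    (h3 : IsInverseTable q (σ.arr 3) q) (h4 : ∀ i, σ.arr 4 i = 0) :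
    Runs w tallyProg σ ((8 * (q / b) + 16) * l.length + 2) fun σ' =>
      Env n B b q ε δ l σ' ∧
        ∀ t < q, σ'.arr 4 t = matchCount t (l : Multiset (Message q b)) := by
  have hlen := hw.len
  have hsq := hw.sq
  have hB := hw.four_le
  have hql := hw.q_lt
  have hqw : q < 2 ^ w := by nlinarith
  let Inv : State → Prop := fun σ => Env n B b q ε δ l σ ∧
      IsInverseTable q (σ.arr 3) q ∧ σ.int 6 ≤ l.length ∧
      ∀ t < q, σ.arr 4 t = matchCount t (l.take (σ.int 6) : Multiset (Message q b))
  have hinit : Runs w (block (.const 6 0) []) σ 1 Inv := by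
    have h6 : (evalBlock w [.const 6 0] σ).int 6 = 0 := Nat.zero_mod _
    refine Runs.block (by simp) ⟨h.of_eq rfl rfl rfl rfl rfl rfl rfl rfl rfl rfl rfl rfl, h3, ?_, ?_⟩
    · rw [h6]; omega
    · intro t _
      rw [h6]
      exact (h4 t).trans (by simp [matchCount])
  have hloop : ∀ σ : State, Inv σ →
      Runs w (.whileLt 6 4 scatterProg) σ ((8 * (q / b) + 16) * l.length + 1) fun σ' =>
        Env n B b q ε δ l σ' ∧
          ∀ t < q, σ'.arr 4 t = matchCount t (l : Multiset (Message q b)) := by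
    intro σ hσ
    refine (Runs.whileLt (c := 5 + (8 * (q / b + 1) + 1 + 1)) Inv (fun σ => l.length - σ.int 6)
      ?_ hσ).mono ?_ ?_
    · rintro σ ⟨hE, h3, hle, h4⟩ hlt
      rw [hE.int_N] at hlt
      set k := σ.int 6 with hk
      have hu := hE.arr_u k hlt
      have hv := hE.arr_v k hlt
      have hw' := hE.arr_w k hlt
      have hu1 := Finset.mem_Icc.1 l[k].1.1.2
      obtain ⟨hcq, hc⟩ := h3 _ hu1.1 (by omega)
      refine Runs.seq (P := fun σ' => Env n B b q ε δ l σ' ∧ σ'.int 6 = k ∧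
          σ'.int 10 = q - (l[k].1.2 : ℕ) ∧ σ'.int 11 = (l[k].2 : ℕ) ∧
          σ'.int 12 = σ.arr 3 (l[k].1.1 : ℕ) ∧ σ'.arr = σ.arr) (Runs.block (by simp)
        ⟨hE.of_eq rfl rfl rfl rfl rfl rfl rfl rfl rfl rfl rfl rfl, rfl, ?_, hw', ?_, rfl⟩) ?_
      · change (σ.int 2 - σ.arr 1 k) % 2 ^ w = _
        rw [hE.int_q, hv]
        exact Nat.mod_eq_of_lt (by omega)
      · change σ.arr 3 (σ.arr 0 k) = _
        rw [hu]
      rintro σ₁ ⟨hE₁, h6₁, h10₁, h11₁, h12₁, harr₁⟩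
      refine (runs_scatter_loop hw (s := l[k].1) (m := l[k].2)
        (f := fun t => matchCount t (l.take k : Multiset (Message q b)))
        (fun t _ => (matchCount_take_le t k).trans_lt hlt) hcq hc l[k].2.2 hE₁ h6₁ h10₁ h11₁ h12₁
        (by rw [harr₁]; exact h3) (by rw [harr₁]; exact h4)).seq ?_
      rintro σ₂ ⟨hE₂, h6₂, h3₂, h4₂⟩
      have h6' : (evalBlock w [.iop .add 6 6 8] σ₂).int 6 = k + 1 := by
        change (σ₂.int 6 + σ₂.int 8) % 2 ^ w = k + 1
        rw [hE₂.int_one, h6₂]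
        exact Nat.mod_eq_of_lt (by omega)
      refine Runs.block (by simp)
        ⟨⟨hE₂.of_eq rfl rfl rfl rfl rfl rfl rfl rfl rfl rfl rfl rfl, h3₂, ?_, ?_⟩, ?_⟩
      · rw [h6']; omega
      · intro t ht
        rw [h6', matchCount_take_succ t k hlt]
        simp only [Fin.ext_iff, hash_val]
        exact h4₂ t ht
      · rw [h6']; omega
    · refine Nat.add_le_add_right (Nat.mul_le_mul (by omega) (by omega)) 1
    · rintro σ' ⟨⟨hE, -, hle, h4⟩, hge⟩
      rw [hE.int_N] at hge
      rw [show σ'.int 6 = l.length by omega, List.take_length] at h4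
      exact ⟨hE, h4⟩
  exact (hinit.seq hloop).mono (by omega) fun _ h => h

/-- Counters are indexed by residues below `q`, but an element may equal `q` when `B = q`. -/
lemma matchCount_mod (x : ℕ) (T : Multiset (Message q b)) :
    matchCount (x % q) T = matchCount x T := by
  have : ∀ s : Seed q, hash b s (x % q) = hash b s x := by
    intro s
    rw [Fin.ext_iff, hash_val, hash_val]
    congr 1
    exact Nat.ModEq.add_right _ (Nat.ModEq.mul_left _ (Nat.mod_modEq x q))
  simp only [matchCount, this]

lemma runs_output (hw : WordFits B b q l.length w) {σ : State} (h : Env n B b q ε δ l σ)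
    (h4 : ∀ t < q, σ.arr 4 t = matchCount t (l : Multiset (Message q b))) :
    Runs w outputProg σ (9 * B + 3) fun σ' => ∀ x, 1 ≤ x → x ≤ B →
      σ'.rarr 0 x = estimate n b q ε δ (l : Multiset (Message q b)) x := by
  have hq0 := (Fact.out : q.Prime).pos
  have h32 := hw.const
  have hsq := hw.sq
  have hB := hw.four_le
  have hql := hw.q_lt
  have hqw : q < 2 ^ w := by nlinarith
  have hBw : 4 * B < 2 ^ w := by nlinarith
  let Inv : State → Prop := fun σ => Env n B b q ε δ l σ ∧
      σ.int 15 = B + 1 ∧ 1 ≤ σ.int 6 ∧ σ.int 6 ≤ B + 1 ∧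
      (∀ t < q, σ.arr 4 t = matchCount t (l : Multiset (Message q b))) ∧
      ∀ x, 1 ≤ x → x < σ.int 6 →
        σ.rarr 0 x = estimate n b q ε δ (l : Multiset (Message q b)) x
  have hinit : Runs w (block (.const 6 1) [.iop .add 15 1 8]) σ 2 Inv := by
    have h6 : (evalBlock w [.const 6 1, .iop .add 15 1 8] σ).int 6 = 1 :=
      Nat.mod_eq_of_lt (by omega : 1 < 2 ^ w)
    refine Runs.block (by simp) ⟨h.of_eq rfl rfl rfl rfl rfl rfl rfl rfl rfl rfl rfl rfl, ?_,
      by rw [h6], by rw [h6]; omega, h4, ?_⟩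
    · change (σ.int 1 + σ.int 8) % 2 ^ w = _
      rw [h.int_B, h.int_one]
      exact Nat.mod_eq_of_lt (by omega)
    · rw [h6]
      intro x h1 h2
      omega
  have hloop : ∀ σ : State, Inv σ →
      Runs w (.whileLt 6 15 (block (.iop .mod 13 6 2) outputInstrs)) σ (9 * B + 1) fun σ' =>
        ∀ x, 1 ≤ x → x ≤ B →
          σ'.rarr 0 x = estimate n b q ε δ (l : Multiset (Message q b)) x := by
    intro σ hσ
    have h1σ := hσ.2.2.1
    refine (Runs.whileLt (c := 8) Inv (fun σ => B + 1 - σ.int 6) ?_ hσ).mono (by omega) ?_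
    · rintro σ ⟨hE, h15, hge, hle, h4, hr⟩ hlt
      rw [h15] at hlt
      set k := σ.int 6 with hk
      have h6' : (evalBlock w (.iop .mod 13 6 2 :: outputInstrs) σ).int 6 = k + 1 := by
        change (σ.int 6 + σ.int 8) % 2 ^ w = k + 1
        rw [hE.int_one]
        exact Nat.mod_eq_of_lt (by omega)
      have hrarr : (evalBlock w (.iop .mod 13 6 2 :: outputInstrs) σ).rarr 0 =
          Function.update (σ.rarr 0) k (estimate n b q ε δ (l : Multiset (Message q b)) k) := by
        change Function.update (σ.rarr 0) k
          (((σ.arr 4 (k % σ.int 2 % 2 ^ w) : ℕ) - σ.real 2 - σ.real 8) / σ.real 11) = _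
        rw [hE.int_q, Nat.mod_eq_of_lt ((Nat.mod_lt k hq0).trans hqw), h4 _ (Nat.mod_lt k hq0),
          matchCount_mod, hE.real_noise, hE.real_col, hE.real_den]
        rfl
      refine Runs.block (by simp [outputInstrs, estimateInstrs])
        ⟨⟨hE.of_eq rfl rfl rfl rfl rfl rfl rfl rfl rfl rfl rfl rfl, h15, ?_, ?_, h4, ?_⟩, ?_⟩
      · rw [h6']; omega
      · rw [h6']; omega
      · rw [h6', hrarr]
        intro x h1 h2
        by_cases hxk : x = k
        · rw [hxk, Function.update_self]
        · rw [Function.update_of_ne hxk]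
          exact hr x h1 (by omega)
      · rw [h6']; omega
    · rintro σ' ⟨⟨hE, h15, -, hle, -, hr⟩, hge⟩ x h1 h2
      rw [h15] at hge
      exact hr x h1 (by omega)
  exact (hinit.seq hloop).mono (by omega) fun _ h => h

lemma runs_queryAll (hw : WordFits B b q l.length w) :
    Runs w queryAllProg (initState n B b q ε δ l 0)
      ((8 * (q / b) + 16) * l.length + 9 * q + 9 * B + 38) fun σ => ∀ x, 1 ≤ x → x ≤ B →
        σ.rarr 0 x = estimate n b q ε δ (l : Multiset (Message q b)) x := by
  have h := (runs_setup (n := n) (ε := ε) (δ := δ) (x := 0) hw).seq fun σ h =>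
    (runs_inverse hw h.1 h.2.2.2.2).seq fun σ' h' =>
      (runs_tally hw h'.1 h'.2.1 h'.2.2).seq fun σ'' h'' => runs_output hw h''.1 h''.2
  exact h.mono (by omega) fun σ h => h

end QueryAll

/-! ### Expected running times -/

section Time

variable {n B b q : ℕ} {ε δ : ℝ} [Fact q.Prime] [NeZero b]

/-- The bound depends on the messages only through their number, so the worst order costs nothing
and the mean number of messages suffices. -/
lemma expectedTime_le {K a c : ℕ} {p : Prog} {x : ℕ} (hρ : 0 ≤ rho n b ε δ)
    (h : ∀ l : List (Message q b), runTime (wordLength K n B l.length) p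
      (initState n B b q ε δ l x) ≤ ((c * l.length + a : ℕ) : ℝ≥0∞)) (D : Fin n → Range1 B) :
    expectedTime K p b q ε δ D x ≤ ENNReal.ofReal (c * (n * (1 + rho n b ε δ)) + a) := by
  calc expectedTime K p b q ε δ D x
      ≤ expect ((FE1 n B b q ε δ).view D) fun T => (c : ℝ≥0∞) * (T.card : ℝ≥0∞) + a := by
        refine expect_mono fun T => iSup₂_le fun l hl => (h l).trans ?_
        rw [← hl]
        simp
    _ = ENNReal.ofReal (c * (n * (1 + rho n b ε δ)) + a) := by
        rw [expect_add, expect_const_mul, expect_const, expect_view_card hρ,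
          ENNReal.ofReal_add (by positivity) (by positivity),
          ENNReal.ofReal_mul (p := (c : ℝ)) (by positivity), ENNReal.ofReal_natCast,
          ENNReal.ofReal_natCast]

lemma mean_messages (hn : 1 ≤ n) :
    n * (1 + rho n b ε δ) = n + 32 * (Real.log (2 / δ) / ε ^ 2 * b) := by
  have h1 : (n : ℝ) ≠ 0 := by positivity
  rw [rho]
  field_simp

lemma expectedTime_query_le (hn : 1 ≤ n) (hb : 2 ≤ b) (hbB : 2 * b ≤ B) (hq : q < 2 * B)
    (hδ : 0 < δ) (hδ1 : δ < 1) (D : Fin n → Range1 B) (x : Range1 B) :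
    expectedTime 4 queryProg b q ε δ D x ≤
      ENNReal.ofReal (1300 * (n + Real.log (2 / δ) / ε ^ 2 * b)) := by
  refine (expectedTime_le (rho_nonneg hδ hδ1) (fun l => runTime_le (runs_query
    (wordFits (by omega) hq hbB) (Finset.mem_Icc.1 x.2).2)) D).trans (ENNReal.ofReal_le_ofReal ?_)
  rw [mean_messages hn]
  have hL : 0 ≤ Real.log (2 / δ) / ε ^ 2 * b := by
    have := log_two_div_gt hδ hδ1
    norm_num at this
    positivity
  have hn1 : (1 : ℝ) ≤ n := by exact_mod_cast hn
  push_cast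
  linarith

lemma expectedTime_queryAll_le (hn : 1 ≤ n) (hb : 2 ≤ b) (hbB : 2 * b ≤ B) (hq : q < 2 * B)
    (h0 : 0 < ε) (h3 : ε ≤ 3) (hδ : 0 < δ) (hδ1 : δ < 1) (D : Fin n → Range1 B) :
    expectedTime 4 queryAllProg b q ε δ D 0 ≤
      ENNReal.ofReal (1300 * (((n : ℝ) / b + Real.log (2 / δ) / ε ^ 2) * B)) := by
  refine (expectedTime_le (c := 8 * (q / b) + 16) (a := 9 * q + 9 * B + 38) (rho_nonneg hδ hδ1)
    (fun l => runTime_le ((runs_queryAll (wordFits (by omega) hq hbB)).mono (by omega)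
      fun _ h => h)) D).trans (ENNReal.ofReal_le_ofReal ?_)
  rw [mean_messages hn]
  have hL := log_two_div_gt hδ hδ1
  norm_num at hL
  set R := Real.log (2 / δ) / ε ^ 2 with hR
  -- Here `ε ≤ 3` gives `R ≥ 0.69 / 9`. This lets `R * B` absorb the cost of the table of inverses
  -- and of the output, which is of order `B` regardless of the noise.
  have hR1 : 0.07 ≤ R := by
    rw [hR, le_div_iff₀ (by positivity)]
    norm_num
    nlinarith
  norm_num at hR1
  have hB4 : (4 : ℝ) ≤ B := by exact_mod_cast (by omega : 4 ≤ B)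
  have hb2 : (2 : ℝ) ≤ b := by exact_mod_cast hb
  have hbB' : (2 : ℝ) * b ≤ B := by exact_mod_cast hbB
  have hq' : (q : ℝ) ≤ 2 * B := by exact_mod_cast hq.le
  have hBb : 2 ≤ (B : ℝ) / b := by rwa [le_div_iff₀ (by linarith)]
  have hc : ((8 * (q / b) + 16 : ℕ) : ℝ) ≤ 24 * (B / b) := by
    have h1 : ((q / b : ℕ) : ℝ) ≤ 2 * B / b := Nat.cast_div_le.trans (by gcongr)
    rw [mul_div_assoc] at h1
    push_cast
    linarith
  have ha : ((9 * q + 9 * B + 38 : ℕ) : ℝ) ≤ 37 * B := by push_cast; linarith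
  have hRB : (7 / 100 : ℝ) * B ≤ R * B := mul_le_mul_of_nonneg_right hR1 (by linarith)
  have hnB : 0 ≤ (n : ℝ) / b * B := by positivity
  calc _ ≤ 24 * ((B : ℝ) / b) * (n + 32 * (R * b)) + 37 * B :=
        add_le_add (mul_le_mul_of_nonneg_right hc (by positivity)) ha
    _ = 24 * ((n : ℝ) / b * B) + 768 * (R * B) + 37 * B := by field_simp; ring
    -- `37 B ≤ (3700 / 7) R B < 529 R B`, and `768 + 529 < 1300`.
    _ ≤ _ := by rw [add_mul]; linarith

end Time

lemma exists_prime_between {B : ℕ} (hB : 2 ≤ B) : ∃ q : ℕ, q.Prime ∧ B ≤ q ∧ q < 2 * B := by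
  -- Bertrand's postulate at `B - 1`, so that `q = B` is allowed and `q < 2 * B` is strict.
  obtain ⟨q, hq, h1, h2⟩ := Nat.exists_prime_lt_and_le_two_mul (B - 1) (by omega)
  exact ⟨q, hq, by omega, by omega⟩

end ShuffleFE

end

theorem theorem3 :
    ∃ (C : ℝ) (Cerr : ℝ → ℝ) (K : ℕ) (query queryAll : ShuffleFE.Prog),
      ∀ (n B b : ℕ) (ε δ : ℝ) [NeZero b],
        1 ≤ n → 2 ≤ b → 2 * b ≤ B → 0 < ε → ε ≤ 3 → 0 < δ → δ < 1 →
        (∃ q : ℕ, q.Prime ∧ B ≤ q ∧ q < 2 * B) ∧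
        ∀ (q : ℕ) [Fact q.Prime], B ≤ q → q < 2 * B →
          -- privacy in the shuffle model
          ShuffleFE.IsDP (fun D : Fin n → ShuffleFE.Range1 B =>
            (ShuffleFE.FE1 n B b q ε δ).view D) ε δ ∧
          -- expected number of messages of each user
          (∀ x : ShuffleFE.Range1 B, (ShuffleFE.FE1 n B b q ε δ).expectedMessages x ≤
            ENNReal.ofReal (1 + C * (Real.log (2 / δ) / ε ^ 2 * ((b : ℝ) / n)))) ∧
          -- message length
          (Function.Injective
              (ShuffleFE.encodeMessage : ShuffleFE.Message q b → BitVec _) ∧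
            (ShuffleFE.messageBits q b : ℝ) ≤ C * Real.log B) ∧
          -- single queries
          (ShuffleFE.AnswersQuery K query n B b q ε δ ∧
            ∀ (D : Fin n → ShuffleFE.Range1 B) (x : ShuffleFE.Range1 B),
              ShuffleFE.expectedTime K query b q ε δ D x ≤
                ENNReal.ofReal (C * (n + Real.log (2 / δ) / ε ^ 2 * b))) ∧
          -- all queries at once
          (ShuffleFE.AnswersAll K queryAll n B b q ε δ ∧
            ∀ D : Fin n → ShuffleFE.Range1 B,
              ShuffleFE.expectedTime K queryAll b q ε δ D 0 ≤
                ENNReal.ofReal (C * (((n : ℝ) / b + Real.log (2 / δ) / ε ^ 2) * B))) ∧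
          -- maximum error, for every constant failure probability
          ∀ β : ℝ, 0 < β → β < 1 →
            ShuffleFE.IsAccurate (ShuffleFE.FE1 n B b q ε δ) n
              (Cerr β * (Real.log B +
                Real.sqrt (Real.log B * ((n : ℝ) / b + Real.log (2 / δ) / ε ^ 2)))) β := by
  -- The time for all queries dictates 1300; the message count needs only 32 and the message length
  -- 12.
  refine ⟨1300, ShuffleFE.errorConst, 4, ShuffleFE.queryProg, ShuffleFE.queryAllProg, ?_⟩
  intro n B b ε δ _ hn hb hbB h0 h3 hδ hδ1
  refine ⟨ShuffleFE.exists_prime_between (by omega), fun q _ hBq hq => ?_⟩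
  have hL : 0 < Real.log (2 / δ) := lt_trans (by norm_num) (ShuffleFE.log_two_div_gt hδ hδ1)
  have hlogB : 0 ≤ Real.log B := Real.log_natCast_nonneg B
  have hfits : ∀ N, ShuffleFE.WordFits B b q N (ShuffleFE.wordLength 4 n B N) :=
    fun N => ShuffleFE.wordFits (by omega) hq hbB
  refine ⟨ShuffleFE.isDP_FE1 hn (by omega) h0 h3 hδ hδ1, fun x => ?_,
    ⟨ShuffleFE.encodeMessage_injective, ?_⟩,
    ⟨fun l x => ?_, ShuffleFE.expectedTime_query_le hn hb hbB hq hδ hδ1⟩,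
    ⟨fun l => ?_, ShuffleFE.expectedTime_queryAll_le hn hb hbB hq h0 h3 hδ hδ1⟩,
    fun β hβ hβ1 => ShuffleFE.isAccurate_FE1 hn hb hbB hBq h0 hδ hδ1 hβ hβ1⟩
  · rw [ShuffleFE.expectedMessages_eq (ShuffleFE.rho_nonneg hδ hδ1)]
    refine ENNReal.ofReal_le_ofReal ?_
    have : 0 ≤ Real.log (2 / δ) / ε ^ 2 * ((b : ℝ) / n) := by positivity
    rw [ShuffleFE.rho, mul_div_assoc, mul_assoc]
    linarith
  · have := ShuffleFE.messageBits_le (b := b) (by omega) hq (by omega)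
    linarith
  · obtain ⟨t, σ, -, he, hr⟩ := ShuffleFE.runs_query (n := n) (ε := ε) (δ := δ) (hfits l.length)
      (Finset.mem_Icc.1 x.2).2
    exact ⟨t, σ, he, hr⟩
  · obtain ⟨t, σ, -, he, hr⟩ := ShuffleFE.runs_queryAll (n := n) (ε := ε) (δ := δ) (hfits l.length)
    exact ⟨t, σ, he, fun x => hr x (Finset.mem_Icc.1 x.2).1 (Finset.mem_Icc.1 x.2).2⟩
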